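/- Fix $\sigma>0$, $\vartheta\in(0,1)$, $r>0$, $a\ge 1$, $c_0>0$ and an integer $m_0\ge 1$, and let $g$ be the smallest integer with $g\ge\max\{m_0,(\vartheta+r)^2/(2\vartheta r)\}$. For $p\ge 2$ put $\epsilon_p=p^{-\vartheta}$ and $\tau_p=\sigma\sqrt{2r\log p}$. **Model.** Let $X$ be a deterministic $n\times p$ matrix with Gram matrix $G=X'X$, and let $Y=X\beta+\sigma z$ with $z\sim N(0,I_n)$ and $\beta=b\circ\mu$ (entrywise product), where $b$ has i.i.d. $\mathrm{Bernoulli}(\epsilon_p)$ entries and is independent of $z$, and where $\mu\in\Theta_p^*(\tau_p,a)=\{\mu\in\mathbb R^p:\tau_p\le|\mu_i|\le a\tau_p,\ 1\le i\le p\}$. The minimax Hamming distance is $$\mathrm{Hamm}_p^*(\vartheta,r,a,X)=\inf_{\hat\beta}\ \sup_{\mu\in\Theta_p^*(\tau_p,a)}E\Big[\sum_{j=1}^p 1\{\mathrm{sgn}(\hat\beta_j)\ne\mathrm{sgn}(\beta_j)\}\Big],$$ the expectation being over $b$ and $z$, and the infimum over all measurable functions $\hat\beta=\hat\beta(Y)\in\mathbb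 R^p$ (which may depend on $X$ and the parameters, but not on $\mu$). **Exponents.** For $V\subset\{1,\dots,p\}$ with indicator vector $I_V$ let $B_V=\{I_V\circ\mu:\mu\in\Theta_p^*(\tau_p,a)\}$. For $V_0,V_1\subset\{1,\dots,p\}$, not both empty, let $$\alpha^*(V_0,V_1)=\min\big\{\tau_p^{-2}(\theta^{(0)}-\theta^{(1)})'G(\theta^{(0)}-\theta^{(1)}):\ \theta^{(i)}\in B_{V_i},\ i=0,1,\ \mathrm{sgn}(\theta^{(0)})\neq\mathrm{sgn}(\theta^{(1)})\big\},$$ $$\eta(V_0,V_1)=\max\{|V_0|,|V_1|\}\,\vartheta+\frac14\Big[\Big(\sqrt{\alpha^*(V_0,V_1)\,r}-\frac{\big||V_1|-|V_0|\big|\,\vartheta}{\sqrt{\alpha^*(V_0,V_1)\,r}}\Big)_+\Big]^2,$$ where the positive part is taken to be $0$ when $\alpha^*(V_0,V_1)=0$. Let $\rho_j^*(\vartheta,r,a,G)=\min\{\eta(V_0,V_1): j\in V_0\cup V_1\}$, and let $(V_{0j}^*,V_{1j}^*)$ be a pair attaining this minimum, ties being broken in any way (for instance lexicographically). **GOLF.**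 In the Graph of Least Favorables $\mathcal G^\diamond$ on $\{1,\dots,p\}$, $j$ and $k$ are adjacent if and only if $V_{0j}^*\cup V_{1j}^*$ and $V_{0k}^*\cup V_{1k}^*$ intersect (so each node is adjacent to itself), and $d_p(\mathcal G^\diamond)$ is the maximum over $j$ of the number of nodes adjacent to $j$, $j$ included. **Claim.** There is a multi-$\log(p)$ sequence $L_p>0$ (that is, $L_pp^{\delta}\to\infty$ and $L_pp^{-\delta}\to0$ as $p\to\infty$ for every $\delta>0$), depending only on $(\sigma,\vartheta,r,a,c_0,m_0)$, such that for all sufficiently large $p$, all $n$, and every deterministic $n\times p$ matrix $X$ whose Gram matrix $G$ has unit diagonal and has all eigenvalues of all its $g\times g$ principal submatrices $\ge c_0$, $$\mathrm{Hamm}_p^*(\vartheta,r,a,X)\ \ge\ L_p\,\big[d_p(\mathcal G^\diamond)\big]^{-1}\sum_{j=1}^p p^{-\rho_j^*(\vartheta,r,a,G)}$$ for every way of breaking the ties. -/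

import Mathlib

open MeasureTheory ProbabilityTheory Filter Topology
open scoped ENNReal Matrix

noncomputable section

namespace GolfBound

/-! ### Signals: the Asymptotic Rare Weak model -/

/-- Sparsity level `ε_p = p ^ (-ϑ)`. -/
def sparsity (ϑ : ℝ) (p : ℕ) : ℝ := (p : ℝ) ^ (-ϑ)

/-- Signal strength `τ_p = σ √(2 r log p)`. -/
def strength (σ r : ℝ) (p : ℕ) : ℝ := σ * Real.sqrt (2 * r * Real.log p)

/-- `Θ_p^*(τ, a)`: vectors all of whose entries have magnitude in `[τ, a τ]`. -/
def signalSet (p : ℕ) (τ a : ℝ) : Set (Fin p → ℝ) :=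
  {μ | (∀ i, τ ≤ |μ i|) ∧ ∀ i, |μ i| ≤ a * τ}

/-- The law of `b = (b_1, …, b_p)` with i.i.d. `Bernoulli(ε)` entries in `{0, 1} ⊂ ℝ`
(`ε` is projected to `[0, 1]`, which changes nothing for a probability). -/
def bernoulliLaw (p : ℕ) (ε : ℝ) : Measure (Fin p → ℝ) :=
  Measure.pi fun _ => bernoulliMeasure (1 : ℝ) 0 (Set.projIcc 0 1 zero_le_one ε)

/-- The law `N(0, I_n)` of the noise. -/
def noiseLaw (n : ℕ) : Measure (Fin n → ℝ) :=
  Measure.pi fun _ => gaussianReal 0 1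

/-! ### Hamming distance and minimax Hamming distance for a fixed design -/

/-- Number of coordinates at which `x` and `y` have different signs. -/
def signErrors {p : ℕ} (x y : Fin p → ℝ) : ℕ :=
  (Finset.univ.filter fun j => SignType.sign (x j) ≠ SignType.sign (y j)).card

/-- `h_p(β̂, β | X)`: the expected number of sign errors of the procedure `est` when
`Y = X β + σ z`, `z ∼ N(0, I_n)`. -/
def hammingRisk {n p : ℕ} (σ : ℝ) (X : Matrix (Fin n) (Fin p) ℝ)
    (est : (Fin n → ℝ) → Fin p → ℝ) (β : Fin p → ℝ) : ℝ≥0∞ :=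
  ∫⁻ z, (signErrors (est (X *ᵥ β + σ • z)) β : ℝ≥0∞) ∂(noiseLaw n)

/-- `H_p(β̂; ε, μ, X)`: the Hamming distance averaged over `β = b ∘ μ` (entrywise product). -/
def bayesHammingRisk {n p : ℕ} (σ ε : ℝ) (X : Matrix (Fin n) (Fin p) ℝ)
    (est : (Fin n → ℝ) → Fin p → ℝ) (μ : Fin p → ℝ) : ℝ≥0∞ :=
  ∫⁻ b, hammingRisk σ X est (b * μ) ∂(bernoulliLaw p ε)

/-- The minimax Hamming distance for the fixed design `X`: infimum over all (measurable)
procedures, which may depend on `X` and on all parameters but not on `μ`, of the supremum over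
`μ ∈ Θ_p^*(τ_p, a)`. -/
def minimaxHamming {n p : ℕ} (σ ϑ r a : ℝ) (X : Matrix (Fin n) (Fin p) ℝ) : ℝ≥0∞ :=
  ⨅ (est : (Fin n → ℝ) → Fin p → ℝ) (_ : Measurable est),
    ⨆ μ ∈ signalSet p (strength σ r p) a, bayesHammingRisk σ (sparsity ϑ p) X est μ

/-! ### The class of Gram matrices -/

/-- The smallest eigenvalue of a symmetric real matrix. -/
def smallestEigenvalue {ι : Type*} [Fintype ι] [DecidableEq ι] (A : Matrix ι ι ℝ) : ℝ :=
  sInf (spectrum ℝ A)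

/-- `λ_k^*(A)`: the minimum of the smallest eigenvalues of the `k × k` principal submatrices
(used for `1 ≤ k ≤ p`). -/
def lambdaStar {p : ℕ} (k : ℕ) (A : Matrix (Fin p) (Fin p) ℝ) : ℝ :=
  ⨅ s : {s : Finset (Fin p) // s.card = k},
    smallestEigenvalue (A.submatrix (fun i : s.1 => (i : Fin p)) fun i : s.1 => (i : Fin p))

/-- `g(m₀, ϑ, r)`: the smallest integer `g ≥ max{m₀, (ϑ + r)² / (2 ϑ r)}`. -/
def gParam (m₀ : ℕ) (ϑ r : ℝ) : ℕ := ⌈max (m₀ : ℝ) ((ϑ + r) ^ 2 / (2 * ϑ * r))⌉₊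

/-- `𝓜_p(c₀, g)`: `p × p` correlation matrices `A` with `λ_g^*(A) ≥ c₀`. -/
def correlationClass (p : ℕ) (c₀ : ℝ) (g : ℕ) : Set (Matrix (Fin p) (Fin p) ℝ) :=
  {A | A.PosSemidef ∧ (∀ i, A i i = 1) ∧ c₀ ≤ lambdaStar g A}

/-! ### Least favorable configurations -/

/-- `B_V = {I_V ∘ μ : μ ∈ Θ_p^*(τ, a)}`. -/
def supportedSignals {p : ℕ} (τ a : ℝ) (V : Finset (Fin p)) : Set (Fin p → ℝ) :=
  (fun μ => (V : Set (Fin p)).indicator μ) '' signalSet p τ a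

/-- `α(θ⁰, θ¹) = τ⁻² (θ⁰ - θ¹)' A (θ⁰ - θ¹)`. -/
def alpha {p : ℕ} (τ : ℝ) (A : Matrix (Fin p) (Fin p) ℝ) (θ₀ θ₁ : Fin p → ℝ) : ℝ :=
  (τ ^ 2)⁻¹ * ((θ₀ - θ₁) ⬝ᵥ (A *ᵥ (θ₀ - θ₁)))

/-- `α^*(V₀, V₁)`: the minimum of `α(θ⁰, θ¹)` over `θ⁰ ∈ B_{V₀}`, `θ¹ ∈ B_{V₁}` with different
sign vectors. -/
def alphaStar {p : ℕ} (τ a : ℝ) (A : Matrix (Fin p) (Fin p) ℝ) (V₀ V₁ : Finset (Fin p)) : ℝ :=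
  sInf {x | ∃ θ₀ ∈ supportedSignals τ a V₀, ∃ θ₁ ∈ supportedSignals τ a V₁,
    (fun i => SignType.sign (θ₀ i)) ≠ (fun i => SignType.sign (θ₁ i)) ∧ x = alpha τ A θ₀ θ₁}

/-- `η(V₀, V₁)`. If `α^* = 0`, the positive part is `0` (with the convention `x / 0 = 0`), which
is also its limiting value as `α^* ↓ 0`. -/
def eta {p : ℕ} (τ ϑ r a : ℝ) (A : Matrix (Fin p) (Fin p) ℝ) (V₀ V₁ : Finset (Fin p)) : ℝ :=
  max (V₀.card : ℝ) (V₁.card : ℝ) * ϑ +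
    (1 / 4) * (max (Real.sqrt (alphaStar τ a A V₀ V₁ * r) -
      |(V₁.card : ℝ) - (V₀.card : ℝ)| * ϑ / Real.sqrt (alphaStar τ a A V₀ V₁ * r)) 0) ^ 2

/-- The pairs `(V₀, V₁)` of subsets of `{1, …, p}` with `j ∈ V₀ ∪ V₁`. -/
def admissiblePairs {p : ℕ} (j : Fin p) : Set (Finset (Fin p) × Finset (Fin p)) :=
  {V | j ∈ V.1 ∪ V.2}

/-- `ρ_j^*`: the minimum of `η` over the (finitely many) pairs with `j ∈ V₀ ∪ V₁`. -/
def rhoStar {p : ℕ} (τ ϑ r a : ℝ) (A : Matrix (Fin p) (Fin p) ℝ) (j : Fin p) : ℝ :=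
  sInf ((fun V : Finset (Fin p) × Finset (Fin p) => eta τ ϑ r a A V.1 V.2) '' admissiblePairs j)

/-- `V` assigns to each `j` a pair `(V_{0j}^*, V_{1j}^*)` minimizing `η` over the pairs with
`j ∈ V₀ ∪ V₁`. Ties may be broken in any way, lexicographically for instance. -/
def IsLeastFavorable {p : ℕ} (τ ϑ r a : ℝ) (A : Matrix (Fin p) (Fin p) ℝ)
    (V : Fin p → Finset (Fin p) × Finset (Fin p)) : Prop :=
  ∀ j, V j ∈ admissiblePairs j ∧
    ∀ W ∈ admissiblePairs j, eta τ ϑ r a A (V j).1 (V j).2 ≤ eta τ ϑ r a A W.1 W.2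

/-! ### The Graph of Least Favorables -/

/-- Adjacency in GOLF: the unions `V_{0j}^* ∪ V_{1j}^*` and `V_{0k}^* ∪ V_{1k}^*` intersect.
In particular every node is adjacent to itself. -/
def golfAdj {p : ℕ} (V : Fin p → Finset (Fin p) × Finset (Fin p)) (j k : Fin p) : Prop :=
  (((V j).1 ∪ (V j).2) ∩ ((V k).1 ∪ (V k).2)).Nonempty

open Classical in
/-- `d_p(𝓖^⋄)`: the maximum over `j` of the number of nodes adjacent to `j` in GOLF
(`j` itself included, so it is at least `1` as soon as `p ≥ 1`). -/
def golfDegree {p : ℕ} (V : Fin p → Finset (Fin p) × Finset (Fin p)) : ℕ :=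
  Finset.univ.sup fun j => (Finset.univ.filter fun k => golfAdj V j k).card

/-! ### Multi-logarithmic terms -/

/-- `L_p > 0` is a multi-`log(p)` term: `L_p p^δ → ∞` and `L_p p^{-δ} → 0` for each `δ > 0`. -/
def IsMultiLog (L : ℕ → ℝ) : Prop :=
  (∀ p, 0 < L p) ∧ ∀ δ : ℝ, 0 < δ →
    Tendsto (fun p : ℕ => L p * (p : ℝ) ^ δ) atTop atTop ∧
    Tendsto (fun p : ℕ => L p * (p : ℝ) ^ (-δ)) atTop (𝓝 0)

end GolfBound

end

namespace GolfBound

/-! ### Gaussian testing -/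

/-! The bound reduces sign recovery to many two-point Gaussian tests. Fix `j`, let `(V₀, V₁)` be its
least favorable pair, `U = V₀ ∪ V₁`, and let `θ₀`, `θ₁` attain `α^*`. Their signs differ somewhere
in `U`, so an estimator without sign errors on `U` tells them apart. When `b` has support `V₀`,
resp. `V₁`, inside `U`, the signal there can be made equal to `θ₀`, resp. `θ₁`; these supports have
probabilities of order `ε^|V₀|` and `ε^|V₁|`. A likelihood ratio comparison (`le_testing_error`) and
a Gaussian tail bound then make the local risk at least `p^(-η)` up to a factor `exp(-O(√log p))`
(`testingFactor_le_localErrorProb`, `le_lintegral_localErrorProb_add`). Comparison with the pair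
`({j}, ∅)` gives `η ≤ ϑ + r / 4` at every minimizer, which bounds `|U|` and makes the constants
uniform in `j` and `X`.

To add up local risks, a greedy choice extracts an independent set `J` of GOLF carrying a fraction
`1 / d` of `∑ p^(-ρ_j)` (`exists_independent_sum_le`). The sets `U_j`, `j ∈ J`, are disjoint, so
errors in them are counted separately by the Hamming distance. One `μ` has to serve all `j` at once:
on each `U_j` a fair coin chooses between completions of `θ₀` and `θ₁`. The supremum over `μ`
dominates the average over coins, and flipping one coin with the others frozen recovers the
two-point problem (`sum_le_two_mul_of_forall_flip`). -/

lemma lintegral_pi_prod {ι : Type*} [Fintype ι] {E : Type*} [MeasurableSpace E]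
    (μ : ι → Measure E) [∀ i, IsProbabilityMeasure (μ i)] {f : ι → E → ℝ≥0∞}
    (hf : ∀ i, Measurable (f i)) :
    ∫⁻ z, ∏ i, f i (z i) ∂(Measure.pi μ) = ∏ i, ∫⁻ x, f i x ∂(μ i) := by
  have hind : iIndepFun (fun i (z : ι → E) => f i (z i)) (Measure.pi μ) :=
    iIndepFun_pi (X := f) fun i => (hf i).aemeasurable
  have := lintegral_prod_eq_prod_lintegral_of_indepFun Finset.univ _ hind
    (fun i => (hf i).comp (measurable_pi_apply i))
  rw [this]
  refine Finset.prod_congr rfl fun i _ => ?_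
  exact (measurePreserving_eval μ i).lintegral_comp (hf i)

lemma gaussianReal_map_sub_eq_withDensity (h : ℝ) :
    (gaussianReal 0 1).map (fun x => x - h) =
      (gaussianReal 0 1).withDensity fun x => ENNReal.ofReal (Real.exp (-(h * x) - h * h / 2)) := by
  rw [gaussianReal_map_sub_const, gaussianReal_of_var_ne_zero _ one_ne_zero,
    gaussianReal_of_var_ne_zero _ one_ne_zero,
    ← withDensity_mul _ (measurable_gaussianPDF _ _) (by fun_prop)]
  congr 1
  ext x
  simp only [gaussianPDF, Pi.mul_apply, gaussianPDFReal]
  rw [← ENNReal.ofReal_mul (by positivity), mul_assoc (√(2 * Real.pi * _))⁻¹, ← Real.exp_add]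
  congr 3
  simp
  ring

/-- Cameron–Martin formula: the density factorizes over coordinates, so it is enough to compare the
two measures on boxes. -/
lemma noiseLaw_map_sub_eq_withDensity {n : ℕ} (h : Fin n → ℝ) :
    (noiseLaw n).map (fun z => z - h) =
      (noiseLaw n).withDensity
        fun z => ENNReal.ofReal (Real.exp (-(h ⬝ᵥ z) - h ⬝ᵥ h / 2)) := by
  have h1 : (noiseLaw n).map (fun z => z - h) =
      Measure.pi fun i => (gaussianReal 0 1).map fun x => x - h i := by
    rw [noiseLaw, ← Measure.pi_map_pi (fun i => by fun_prop)]
    rfl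
  have : ∀ i, IsProbabilityMeasure ((gaussianReal 0 1).map fun x => x - h i) :=
    fun i => Measure.isProbabilityMeasure_map (by fun_prop)
  rw [h1]
  refine Measure.pi_eq fun s hs => ?_
  rw [withDensity_apply _ (MeasurableSet.univ_pi hs), ← lintegral_indicator (MeasurableSet.univ_pi hs)]
  have h2 : (Set.univ.pi s).indicator
      (fun z => ENNReal.ofReal (Real.exp (-(h ⬝ᵥ z) - h ⬝ᵥ h / 2))) =
      fun z => ∏ i, (s i).indicator
        (fun x => ENNReal.ofReal (Real.exp (-(h i * x) - h i * h i / 2))) (z i) := by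
    ext z
    by_cases hz : z ∈ Set.univ.pi s
    · rw [Set.indicator_of_mem hz, Finset.prod_congr rfl fun i _ =>
        Set.indicator_of_mem (hz i trivial) _, ← ENNReal.ofReal_prod_of_nonneg
        (fun i _ => by positivity), ← Real.exp_sum]
      congr 2
      simp only [dotProduct, Finset.sum_sub_distrib, Finset.sum_neg_distrib, Finset.sum_div]
    · rw [Set.indicator_of_notMem hz]
      simp only [Set.mem_pi, Set.mem_univ, true_implies, not_forall] at hz
      obtain ⟨i, hi⟩ := hz
      exact (Finset.prod_eq_zero (Finset.mem_univ i) (Set.indicator_of_notMem hi _)).symm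
  rw [h2, noiseLaw, lintegral_pi_prod]
  · refine Finset.prod_congr rfl fun i _ => ?_
    rw [gaussianReal_map_sub_eq_withDensity, withDensity_apply _ (hs i), lintegral_indicator (hs i)]
  · exact fun i => Measurable.indicator (by fun_prop) (hs i)

lemma noiseLaw_map_dotProduct {n : ℕ} (h : Fin n → ℝ) :
    (noiseLaw n).map (fun z => h ⬝ᵥ z) = gaussianReal 0 (h ⬝ᵥ h).toNNReal := by
  have hm : Measurable fun z : Fin n → ℝ => h ⬝ᵥ z := by unfold dotProduct; fun_prop
  have : IsProbabilityMeasure (noiseLaw n) := by unfold noiseLaw; infer_instance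
  have : IsProbabilityMeasure ((noiseLaw n).map fun z => h ⬝ᵥ z) :=
    Measure.isProbabilityMeasure_map hm.aemeasurable
  have hnn : 0 ≤ h ⬝ᵥ h := Finset.sum_nonneg fun i _ => mul_self_nonneg _
  refine Measure.ext_of_charFun (funext fun t => ?_)
  rw [charFun_gaussianReal, charFun_apply_real, integral_map hm.aemeasurable (by fun_prop)]
  have : (fun z : Fin n → ℝ => Complex.exp (t * (h ⬝ᵥ z : ℝ) * Complex.I)) =
      fun z => ∏ i, Complex.exp ((t * h i : ℝ) * (z i : ℝ) * Complex.I) := by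
    ext z
    rw [← Complex.exp_sum]
    congr 1
    simp only [dotProduct, Complex.ofReal_sum, Finset.mul_sum, Finset.sum_mul]
    refine Finset.sum_congr rfl fun i _ => ?_
    push_cast; ring
  rw [this, noiseLaw, integral_fintype_prod_eq_prod
    (fun i (x : ℝ) => Complex.exp ((t * h i : ℝ) * (x : ℝ) * Complex.I))]
  simp_rw [← charFun_apply_real, charFun_gaussianReal]
  rw [← Complex.exp_sum]
  congr 1
  rw [Real.coe_toNNReal _ hnn]
  simp only [dotProduct]
  push_cast
  rw [Finset.sum_mul, Finset.sum_div, mul_zero, zero_mul, zero_sub, ← Finset.sum_neg_distrib]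
  refine Finset.sum_congr rfl fun i _ => ?_
  simp
  ring

/-- Lower bound for the upper tail of the standard normal distribution. -/
noncomputable def tailBound (s : ℝ) : ℝ := (Real.sqrt (2 * Real.pi))⁻¹ * Real.exp (-(s + 1) ^ 2 / 2)

lemma tailBound_le_gaussianReal {s : ℝ} (hs : 0 ≤ s) :
    ENNReal.ofReal (tailBound s) ≤ gaussianReal 0 1 (Set.Ici s) := by
  calc ENNReal.ofReal (tailBound s)
      = ∫⁻ x in Set.Icc s (s + 1), ENNReal.ofReal (tailBound s) := by simp
    _ ≤ ∫⁻ x in Set.Icc s (s + 1), gaussianPDF 0 1 x := by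
        refine setLIntegral_mono (measurable_gaussianPDF _ _) fun x hx => ?_
        refine ENNReal.ofReal_le_ofReal ?_
        simp only [tailBound, gaussianPDFReal, NNReal.coe_one, mul_one, sub_zero]
        gcongr ?_ * Real.exp (-?_ / 2)
        exact pow_le_pow_left₀ (hs.trans hx.1) hx.2 2
    _ ≤ ∫⁻ x in Set.Ici s, gaussianPDF 0 1 x := lintegral_mono_set Set.Icc_subset_Ici_self
    _ = _ := (gaussianReal_apply 0 one_ne_zero _).symm

lemma tailBound_le_one {s : ℝ} (hs : 0 ≤ s) : ENNReal.ofReal (tailBound s) ≤ 1 :=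
  (tailBound_le_gaussianReal hs).trans prob_le_one

/-- The Gaussian probability of a half-space. -/
lemma tailBound_le_noiseLaw_halfSpace {n : ℕ} (h : Fin n → ℝ) {l s : ℝ} (hl : 0 ≤ l) (hs : 0 ≤ s)
    (hls : Real.sqrt (h ⬝ᵥ h) / 2 - l / Real.sqrt (h ⬝ᵥ h) ≤ s) :
    ENNReal.ofReal (tailBound s) ≤ noiseLaw n {z | h ⬝ᵥ z + h ⬝ᵥ h / 2 ≤ l} := by
  have : IsProbabilityMeasure (noiseLaw n) := by unfold noiseLaw; infer_instance
  have hm : Measurable fun z : Fin n → ℝ => h ⬝ᵥ z := by unfold dotProduct; fun_prop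
  have hnn : 0 ≤ h ⬝ᵥ h := Finset.sum_nonneg fun i _ => mul_self_nonneg _
  -- If `h = 0` the half-space is everything, since `l ≥ 0`; otherwise project on the unit vector
  -- `-h / |h|` to obtain a standard normal variable.
  rcases hnn.eq_or_lt with h0 | hpos
  · have hz : h = 0 := dotProduct_self_eq_zero.1 h0.symm
    subst hz
    simpa [hl] using tailBound_le_one hs
  · set v := Real.sqrt (h ⬝ᵥ h) with hv
    have hvpos : 0 < v := Real.sqrt_pos.2 hpos
    have hvv : v * v = h ⬝ᵥ h := Real.mul_self_sqrt hnn
    have hmap : (noiseLaw n).map (fun z => (-v⁻¹ • h) ⬝ᵥ z) = gaussianReal 0 1 := by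
      rw [noiseLaw_map_dotProduct]
      congr 1
      rw [Real.toNNReal_eq_one]
      simp only [dotProduct_smul, smul_dotProduct, smul_eq_mul, ← hvv]
      field_simp
    have hm' : Measurable fun z : Fin n → ℝ => (-v⁻¹ • h) ⬝ᵥ z := by unfold dotProduct; fun_prop
    refine (tailBound_le_gaussianReal hs).trans ?_
    rw [← hmap, Measure.map_apply hm' measurableSet_Ici]
    refine measure_mono fun z hz => ?_
    simp only [Set.mem_preimage, Set.mem_Ici, smul_dotProduct, smul_eq_mul] at hz
    simp only [Set.mem_ofPred_eq]
    have h1 := hls.trans hz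
    have h2 := mul_le_mul_of_nonneg_left h1 hvpos.le
    have h3 : v * (v / 2 - l / v) = h ⬝ᵥ h / 2 - l := by rw [← hvv]; field_simp
    have h4 : v * (-v⁻¹ * (h ⬝ᵥ z)) = -(h ⬝ᵥ z) := by field_simp
    rw [h3, h4] at h2
    linarith

/-- Lower bound for the weighted sum of the error probabilities of a test between `N(-h, I_n)` and
`N(0, I_n)`. -/
lemma le_testing_error {n : ℕ} (h : Fin n → ℝ) {w₀ w₁ s : ℝ} (hw₁ : 0 < w₁) (hw : w₁ ≤ w₀)
    (hs : 0 ≤ s)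
    (hws : Real.sqrt (h ⬝ᵥ h) / 2 - Real.log (w₀ / w₁) / Real.sqrt (h ⬝ᵥ h) ≤ s)
    {B : Set (Fin n → ℝ)} (hB : MeasurableSet B) :
    ENNReal.ofReal (w₁ * tailBound s) ≤ ENNReal.ofReal w₀ * noiseLaw n ((fun z => z - h) ⁻¹' B) +
      ENNReal.ofReal w₁ * noiseLaw n Bᶜ := by
  have hw₀ : 0 < w₀ := hw₁.trans_le hw
  -- On `E` the density of `N(-h, I)` relative to `N(0, I)` is at least `w₁ / w₀`. There, either
  -- decision costs at least `w₁` per unit of `N(0, I)`-mass, so the total error is at least `w₁ *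
  -- noiseLaw n E`.
  set E : Set (Fin n → ℝ) := {z | h ⬝ᵥ z + h ⬝ᵥ h / 2 ≤ Real.log (w₀ / w₁)} with hE
  have hm : Measurable fun z : Fin n → ℝ => h ⬝ᵥ z := by unfold dotProduct; fun_prop
  have hEm : MeasurableSet E := measurableSet_le (by fun_prop) measurable_const
  have h1 : ENNReal.ofReal w₁ * noiseLaw n (B ∩ E) ≤
      ENNReal.ofReal w₀ * noiseLaw n ((fun z => z - h) ⁻¹' B) := by
    rw [← Measure.map_apply (by fun_prop) hB, noiseLaw_map_sub_eq_withDensity,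
      withDensity_apply _ hB]
    calc ENNReal.ofReal w₁ * noiseLaw n (B ∩ E)
        = ENNReal.ofReal w₀ * ∫⁻ z in B ∩ E, ENNReal.ofReal (w₁ / w₀) ∂(noiseLaw n) := by
          rw [setLIntegral_const, ← mul_assoc, ← ENNReal.ofReal_mul hw₀.le,
            mul_div_cancel₀ _ hw₀.ne']
      _ ≤ ENNReal.ofReal w₀ * ∫⁻ z in B ∩ E,
            ENNReal.ofReal (Real.exp (-(h ⬝ᵥ z) - h ⬝ᵥ h / 2)) ∂(noiseLaw n) := by
          gcongr ENNReal.ofReal w₀ * ?_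
          refine setLIntegral_mono' (hB.inter hEm) fun z hz => ENNReal.ofReal_le_ofReal ?_
          have hz2 : h ⬝ᵥ z + h ⬝ᵥ h / 2 ≤ Real.log (w₀ / w₁) := hz.2
          rw [← Real.log_le_iff_le_exp (by positivity), ← inv_div, Real.log_inv]
          linarith
      _ ≤ _ := by
          gcongr
          exact Set.inter_subset_left
  have h2 : noiseLaw n E ≤ noiseLaw n (B ∩ E) + noiseLaw n Bᶜ := by
    refine (measure_mono fun z hz => ?_).trans (measure_union_le _ _)
    by_cases hzB : z ∈ B
    · exact Or.inl ⟨hzB, hz⟩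
    · exact Or.inr hzB
  have h3 := tailBound_le_noiseLaw_halfSpace h
    (Real.log_nonneg ((one_le_div hw₁).2 hw)) hs hws
  calc ENNReal.ofReal (w₁ * tailBound s)
      ≤ ENNReal.ofReal w₁ * (noiseLaw n (B ∩ E) + noiseLaw n Bᶜ) := by
        rw [ENNReal.ofReal_mul hw₁.le]
        gcongr
        exact h3.trans h2
    _ ≤ _ := by
        rw [mul_add]
        gcongr

/-! ### Rare signals -/

/-- Probability that i.i.d. `Bernoulli(ε)` indicators on `S` have success set `W ⊆ S`. -/
noncomputable def patternProb {ι : Type*} (ε : ℝ) (S W : Finset ι) : ℝ :=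
  ε ^ W.card * (1 - ε) ^ (S.card - W.card)

lemma patternProb_nonneg {ι : Type*} {ε : ℝ} (h0 : 0 ≤ ε) (h1 : ε ≤ 1) (S W : Finset ι) :
    0 ≤ patternProb ε S W :=
  mul_nonneg (pow_nonneg h0 _) (pow_nonneg (sub_nonneg.2 h1) _)

lemma sum_patternProb {ι : Type*} (ε : ℝ) (S : Finset ι) :
    ∑ W ∈ S.powerset, patternProb ε S W = 1 := by
  simp only [patternProb]
  rw [Finset.sum_pow_mul_eq_add_pow, add_sub_cancel, one_pow]

lemma patternProb_union {ι : Type*} [DecidableEq ι] [Fintype ι] (ε : ℝ) {U V W : Finset ι}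
    (hV : V ⊆ U) (hW : W ⊆ Uᶜ) :
    patternProb ε Finset.univ (W ∪ V) = patternProb ε Uᶜ W * patternProb ε U V := by
  have hd : Disjoint W V := (Finset.disjoint_of_subset_left hW
    (Finset.disjoint_of_subset_right hV disjoint_compl_left))
  have h1 := Finset.card_le_card hV
  have h2 := Finset.card_le_card hW
  have h3 := Finset.card_add_card_compl U
  simp only [patternProb]
  rw [Finset.card_union_of_disjoint hd, Finset.card_univ,
    show Fintype.card ι - (W.card + V.card) = (Uᶜ.card - W.card) + (U.card - V.card) by omega,
    pow_add, pow_add]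
  ring

lemma bernoulliLaw_singleton {p : ℕ} {ε : ℝ} (h0 : 0 ≤ ε) (h1 : ε ≤ 1) (W : Finset (Fin p)) :
    bernoulliLaw p ε {(W : Set (Fin p)).indicator 1} =
      ENNReal.ofReal (patternProb ε Finset.univ W) := by
  have hε : ε ∈ Set.Icc (0 : ℝ) 1 := ⟨h0, h1⟩
  have hproj : Set.projIcc (0 : ℝ) 1 zero_le_one ε = ⟨ε, hε⟩ :=
    Set.projIcc_of_mem zero_le_one hε
  have hone : bernoulliMeasure (1 : ℝ) 0 ⟨ε, hε⟩ {1} = ENNReal.ofReal ε := by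
    rw [bernoulliMeasure_apply_of_mem_of_notMem _ (measurableSet_singleton _) (by simp) (by simp),
      ENNReal.ofReal, unitInterval.toNNReal]
    refine congrArg ENNReal.ofNNReal (NNReal.eq ?_)
    exact (Real.coe_toNNReal ε h0).symm
  have hzero : bernoulliMeasure (1 : ℝ) 0 ⟨ε, hε⟩ {0} = ENNReal.ofReal (1 - ε) := by
    rw [bernoulliMeasure_apply_of_notMem_of_mem _ (measurableSet_singleton _) (by simp) (by simp),
      ENNReal.ofReal, unitInterval.toNNReal]
    refine congrArg ENNReal.ofNNReal (NNReal.eq ?_)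
    exact (Real.coe_toNNReal (1 - ε) (sub_nonneg.2 h1)).symm
  rw [bernoulliLaw, hproj, Measure.pi_singleton, patternProb,
    ENNReal.ofReal_mul (pow_nonneg h0 _), ENNReal.ofReal_pow h0,
    ENNReal.ofReal_pow (sub_nonneg.2 h1), ← Finset.prod_mul_prod_compl W, Finset.card_univ,
    ← Finset.card_compl]
  congr 1
  · refine Finset.prod_eq_pow_card fun i hi => ?_
    rw [Set.indicator_of_mem (by exact_mod_cast hi), Pi.one_apply, hone]
  · refine Finset.prod_eq_pow_card fun i hi => ?_
    rw [Set.indicator_of_notMem (by simpa using hi), hzero]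

/-- Keeping only finitely many atoms of the law of `b` gives a lower bound that needs no
measurability of `f`. -/
lemma sum_patternProb_le_lintegral {p : ℕ} {ε : ℝ} (h0 : 0 ≤ ε) (h1 : ε ≤ 1)
    (f : (Fin p → ℝ) → ℝ≥0∞) (𝒲 : Finset (Finset (Fin p))) :
    ∑ W ∈ 𝒲, ENNReal.ofReal (patternProb ε Finset.univ W) * f ((W : Set (Fin p)).indicator 1) ≤
      ∫⁻ b, f b ∂(bernoulliLaw p ε) := by
  classical
  have hinj : Function.Injective
      fun W : Finset (Fin p) => (W : Set (Fin p)).indicator (1 : Fin p → ℝ) := by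
    intro W W' h
    ext i
    have := congrFun h i
    by_cases hi : i ∈ W <;> by_cases hi' : i ∈ W' <;> simp_all [Set.indicator]
  calc _ = ∑ x ∈ 𝒲.image fun W : Finset (Fin p) => (W : Set (Fin p)).indicator (1 : Fin p → ℝ),
        f x * bernoulliLaw p ε {x} := by
        rw [Finset.sum_image hinj.injOn]
        refine Finset.sum_congr rfl fun W _ => ?_
        rw [bernoulliLaw_singleton h0 h1, mul_comm]
    _ = ∫⁻ b in (𝒲.image fun W : Finset (Fin p) => (W : Set (Fin p)).indicator (1 : Fin p → ℝ) :
          Finset (Fin p → ℝ)), f b ∂(bernoulliLaw p ε) := (lintegral_finset _ _).symm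
    _ ≤ _ := setLIntegral_le_lintegral _ _

/-- Restricting the rare-signal law to the event that the success set meets `U` in `V`. -/
lemma sum_patternProb_compl_le_lintegral {p : ℕ} {ε : ℝ} (h0 : 0 ≤ ε) (h1 : ε ≤ 1)
    (f : (Fin p → ℝ) → ℝ≥0∞) {U V : Finset (Fin p)} (hV : V ⊆ U) :
    ∑ W ∈ Uᶜ.powerset, ENNReal.ofReal (patternProb ε Uᶜ W) *
      (ENNReal.ofReal (patternProb ε U V) * f (((W ∪ V : Finset (Fin p)) : Set (Fin p)).indicator 1)) ≤
      ∫⁻ b, f b ∂(bernoulliLaw p ε) := by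
  have hinj : Set.InjOn (fun W => W ∪ V) (Uᶜ.powerset : Set (Finset (Fin p))) := by
    intro W hW W' hW' h
    have aux : ∀ W ∈ Uᶜ.powerset, (W ∪ V) \ V = W := fun W hW =>
      Finset.union_sdiff_cancel_right (Finset.disjoint_of_subset_left (Finset.mem_powerset.1 hW)
        (Finset.disjoint_of_subset_right hV disjoint_compl_left))
    rw [← aux W hW, ← aux W' hW']
    exact congrArg (· \ V) h
  refine le_trans (le_of_eq ?_)
    (sum_patternProb_le_lintegral h0 h1 f (Uᶜ.powerset.image fun W => W ∪ V))
  rw [Finset.sum_image hinj]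
  refine Finset.sum_congr rfl fun W hW => ?_
  rw [patternProb_union ε hV (Finset.mem_powerset.1 hW),
    ENNReal.ofReal_mul (patternProb_nonneg h0 h1 _ _), mul_assoc]

/-! ### Least favorable signals -/

lemma apply_of_notMem_of_mem_supportedSignals {p : ℕ} {τ a : ℝ} {V : Finset (Fin p)}
    {θ : Fin p → ℝ} (hθ : θ ∈ supportedSignals τ a V) {i : Fin p} (hi : i ∉ V) : θ i = 0 := by
  obtain ⟨μ, -, rfl⟩ := hθ
  simp [hi]

lemma eq_zero_or_le_abs_of_mem_supportedSignals {p : ℕ} {τ a : ℝ} {V : Finset (Fin p)}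
    {θ : Fin p → ℝ} (hθ : θ ∈ supportedSignals τ a V) (i : Fin p) : θ i = 0 ∨ τ ≤ |θ i| := by
  obtain ⟨μ, hμ, rfl⟩ := hθ
  by_cases hi : i ∈ V
  · right
    simpa [hi] using hμ.1 i
  · left
    simp [hi]

lemma isCompact_supportedSignals {p : ℕ} (τ a : ℝ) (V : Finset (Fin p)) :
    IsCompact (supportedSignals τ a V) := by
  have h1 : IsCompact {x : ℝ | τ ≤ |x| ∧ |x| ≤ a * τ} := by
    refine (isCompact_Icc (a := -(a * τ)) (b := a * τ)).of_isClosed_subset ?_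
      fun x hx => abs_le.1 hx.2
    exact (isClosed_le continuous_const continuous_abs).inter
      (isClosed_le continuous_abs continuous_const)
  have h2 : signalSet p τ a = Set.univ.pi fun _ => {x : ℝ | τ ≤ |x| ∧ |x| ≤ a * τ} := by
    ext μ
    simp [signalSet, forall_and]
  refine IsCompact.image (h2 ▸ isCompact_univ_pi fun _ => h1) (continuous_pi fun i => ?_)
  by_cases hi : i ∈ V
  · simpa [hi] using continuous_apply i
  · simpa [hi] using continuous_const

/-- The gap between `0` and `τ` turns disagreement of signs into a closed condition, which is what
compactness needs for `α^*` to be attained. -/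
lemma sign_ne_sign_iff {τ x y : ℝ} (hτ : 0 < τ) (hx : x = 0 ∨ τ ≤ |x|) (hy : y = 0 ∨ τ ≤ |y|) :
    SignType.sign x ≠ SignType.sign y ↔ x * y ≤ 0 ∧ τ ≤ |x - y| := by
  rcases lt_trichotomy x 0 with h | rfl | h <;> rcases lt_trichotomy y 0 with h' | rfl | h'
  · have : 0 < x * y := mul_pos_of_neg_of_neg h h'
    simp [sign_neg h, sign_neg h', this]
  · simpa [sign_neg h, h.ne] using hx
  · have hx' := hx.resolve_left h.ne
    rw [abs_of_neg h] at hx'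
    have : x * y ≤ 0 := (mul_neg_of_neg_of_pos h h').le
    simp only [sign_neg h, sign_pos h', this, true_and]
    refine ⟨fun _ => ?_, fun _ => by decide⟩
    rw [abs_of_neg (by linarith)]
    linarith
  · simpa [sign_neg h', h'.ne] using hy
  · simp [hτ]
  · simpa [sign_pos h', h'.ne'] using hy
  · have hx' := hx.resolve_left h.ne'
    rw [abs_of_pos h] at hx'
    have : x * y ≤ 0 := (mul_neg_of_pos_of_neg h h').le
    simp only [sign_pos h, sign_neg h', this, true_and]
    refine ⟨fun _ => ?_, fun _ => by decide⟩
    rw [abs_of_pos (by linarith)]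
    linarith
  · simpa [sign_pos h, h.ne'] using hx
  · have : 0 < x * y := mul_pos h h'
    simp [sign_pos h, sign_pos h', this]

lemma const_mem_signalSet {p : ℕ} {τ a x : ℝ} (hτ : 0 ≤ τ) (ha : 1 ≤ a) (hx : |x| = τ) :
    (fun _ => x) ∈ signalSet p τ a :=
  ⟨fun _ => hx.ge, fun _ => hx.le.trans (le_mul_of_one_le_left hτ ha)⟩

/-- The minimum in the definition of `α^*` is attained. -/
lemma exists_alpha_eq_alphaStar {p : ℕ} {τ a : ℝ} (hτ : 0 < τ) (ha : 1 ≤ a)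
    (A : Matrix (Fin p) (Fin p) ℝ) {V₀ V₁ : Finset (Fin p)} {j : Fin p} (hj : j ∈ V₀ ∪ V₁) :
    ∃ θ₀ ∈ supportedSignals τ a V₀, ∃ θ₁ ∈ supportedSignals τ a V₁,
      (∃ i, SignType.sign (θ₀ i) ≠ SignType.sign (θ₁ i)) ∧
      alphaStar τ a A V₀ V₁ = alpha τ A θ₀ θ₁ := by
  set S : Set ((Fin p → ℝ) × (Fin p → ℝ)) :=
    (supportedSignals τ a V₀ ×ˢ supportedSignals τ a V₁) ∩
      ⋃ i, {q | q.1 i * q.2 i ≤ 0 ∧ τ ≤ |q.1 i - q.2 i|} with hS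
  have hmem : ∀ q, q ∈ S ↔ q.1 ∈ supportedSignals τ a V₀ ∧ q.2 ∈ supportedSignals τ a V₁ ∧
      ∃ i, SignType.sign (q.1 i) ≠ SignType.sign (q.2 i) := by
    intro q
    simp only [hS, Set.mem_inter_iff, Set.mem_prod, Set.mem_iUnion, Set.mem_ofPred_eq, and_assoc]
    refine and_congr_right fun h0 => and_congr_right fun h1 => exists_congr fun i => ?_
    exact (sign_ne_sign_iff hτ (eq_zero_or_le_abs_of_mem_supportedSignals h0 i)
      (eq_zero_or_le_abs_of_mem_supportedSignals h1 i)).symm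
  have hScomp : IsCompact S := by
    refine ((isCompact_supportedSignals τ a V₀).prod (isCompact_supportedSignals τ a V₁)).inter_right
      (isClosed_iUnion_of_finite fun i => ?_)
    have hmul : Continuous fun q : (Fin p → ℝ) × (Fin p → ℝ) => q.1 i * q.2 i := by fun_prop
    have hsub : Continuous fun q : (Fin p → ℝ) × (Fin p → ℝ) => |q.1 i - q.2 i| := by fun_prop
    exact (isClosed_le hmul continuous_const).inter (isClosed_le continuous_const hsub)
  have hSne : S.Nonempty := by
    -- Opposite constants make the signs at `j` differ also when `j` lies in both sets.
    refine ⟨((V₀ : Set (Fin p)).indicator fun _ => τ, (V₁ : Set (Fin p)).indicator fun _ => -τ),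
      (hmem _).2 ⟨⟨_, const_mem_signalSet hτ.le ha (abs_of_pos hτ), rfl⟩,
        ⟨_, const_mem_signalSet hτ.le ha ((abs_neg τ).trans (abs_of_pos hτ)), rfl⟩, j, ?_⟩⟩
    have hneg : -τ < 0 := neg_neg_of_pos hτ
    by_cases h0 : j ∈ V₀ <;> by_cases h1 : j ∈ V₁ <;>
      simp_all [sign_pos hτ, sign_neg hneg]
  have hcont : Continuous fun q : (Fin p → ℝ) × (Fin p → ℝ) => alpha τ A q.1 q.2 := by
    unfold alpha
    fun_prop
  have himg : {x | ∃ θ₀ ∈ supportedSignals τ a V₀, ∃ θ₁ ∈ supportedSignals τ a V₁,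
      (fun i => SignType.sign (θ₀ i)) ≠ (fun i => SignType.sign (θ₁ i)) ∧ x = alpha τ A θ₀ θ₁} =
      (fun q : (Fin p → ℝ) × (Fin p → ℝ) => alpha τ A q.1 q.2) '' S := by
    ext x
    constructor
    · rintro ⟨θ₀, h0, θ₁, h1, hne, rfl⟩
      exact ⟨(θ₀, θ₁), (hmem _).2 ⟨h0, h1, Function.ne_iff.1 hne⟩, rfl⟩
    · rintro ⟨q, hq, rfl⟩
      obtain ⟨h0, h1, hne⟩ := (hmem _).1 hq
      exact ⟨_, h0, _, h1, Function.ne_iff.2 hne, rfl⟩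
  obtain ⟨q, hq, hqe⟩ := (hScomp.image hcont).sInf_mem (hSne.image _)
  obtain ⟨h0, h1, hne⟩ := (hmem _).1 hq
  exact ⟨_, h0, _, h1, hne, by rw [alphaStar, himg]; exact hqe.symm⟩

lemma alpha_transpose_mul {n p : ℕ} (τ : ℝ) (X : Matrix (Fin n) (Fin p) ℝ) (θ₀ θ₁ : Fin p → ℝ) :
    alpha τ (X.transpose * X) θ₀ θ₁ =
      (τ ^ 2)⁻¹ * ((X *ᵥ (θ₀ - θ₁)) ⬝ᵥ (X *ᵥ (θ₀ - θ₁))) := by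
  rw [alpha, ← Matrix.mulVec_mulVec, Matrix.dotProduct_mulVec, Matrix.vecMul_transpose]

lemma dotProduct_self_nonneg' {n : ℕ} (v : Fin n → ℝ) : 0 ≤ v ⬝ᵥ v :=
  Finset.sum_nonneg fun _ _ => mul_self_nonneg _

lemma alphaStar_singleton_le_one {n p : ℕ} {τ a : ℝ} (hτ : 0 < τ) (ha : 1 ≤ a)
    (X : Matrix (Fin n) (Fin p) ℝ) {j : Fin p} (hX : (X.transpose * X) j j = 1) :
    alphaStar τ a (X.transpose * X) {j} ∅ ≤ 1 := by
  have hc := const_mem_signalSet (p := p) hτ.le ha (abs_of_pos hτ)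
  refine csInf_le ⟨0, ?_⟩ ⟨_, ⟨_, hc, rfl⟩, _, ⟨_, hc, rfl⟩, fun h => ?_, ?_⟩
  · rintro x ⟨θ₀, -, θ₁, -, -, rfl⟩
    rw [alpha_transpose_mul]
    exact mul_nonneg (by positivity) (dotProduct_self_nonneg' _)
  · have := congrFun h j
    simp [sign_pos hτ] at this
  · have : ((({j} : Finset (Fin p)) : Set (Fin p)).indicator (fun _ => τ) -
        ((∅ : Finset (Fin p)) : Set (Fin p)).indicator fun _ => τ) = Pi.single j τ := by
      ext i
      by_cases hi : i = j
      · subst hi; simp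
      · simp [hi]
    rw [alpha, this, Matrix.mulVec_single, single_dotProduct]
    simp [hX]
    field_simp

lemma eta_singleton_le {n p : ℕ} {τ ϑ r a : ℝ} (hτ : 0 < τ) (hϑ : 0 < ϑ) (hr : 0 < r) (ha : 1 ≤ a)
    (X : Matrix (Fin n) (Fin p) ℝ) {j : Fin p} (hX : (X.transpose * X) j j = 1) :
    eta τ ϑ r a (X.transpose * X) {j} ∅ ≤ ϑ + r / 4 := by
  have h1 := alphaStar_singleton_le_one hτ ha X hX
  set α := alphaStar τ a (X.transpose * X) {j} ∅
  have h2 : max (Real.sqrt (α * r) -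
      |((∅ : Finset (Fin p)).card : ℝ) - (({j} : Finset (Fin p)).card : ℝ)| * ϑ /
        Real.sqrt (α * r)) 0 ≤ Real.sqrt r := by
    refine max_le ?_ (Real.sqrt_nonneg r)
    refine (sub_le_self _ (by positivity)).trans (Real.sqrt_le_sqrt ?_)
    nlinarith
  have h3 := pow_le_pow_left₀ (le_max_right _ _) h2 2
  rw [Real.sq_sqrt hr.le] at h3
  rw [eta]
  have h4 : max ((({j} : Finset (Fin p)).card : ℕ) : ℝ) (((∅ : Finset (Fin p)).card : ℕ) : ℝ) = 1 := by
    simp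
  rw [h4]
  linarith

lemma strength_pos {σ r : ℝ} {p : ℕ} (hσ : 0 < σ) (hr : 0 < r) (hp : 2 ≤ p) :
    0 < strength σ r p := by
  have : 0 < Real.log p := Real.log_pos (by exact_mod_cast hp)
  unfold strength
  positivity

/-- The competitor `({j}, ∅)` has `α^* ≤ 1` because the diagonal of the Gram matrix is `1`. The
resulting bound depends on neither `p` nor `X`. -/
lemma eta_le_of_isLeastFavorable {n p : ℕ} {σ ϑ r a : ℝ} (hσ : 0 < σ) (hϑ : 0 < ϑ) (hr : 0 < r)
    (ha : 1 ≤ a) (hp : 2 ≤ p) {X : Matrix (Fin n) (Fin p) ℝ}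
    (hX : ∀ i, (X.transpose * X) i i = 1) {V : Fin p → Finset (Fin p) × Finset (Fin p)}
    (hV : IsLeastFavorable (strength σ r p) ϑ r a (X.transpose * X) V) (j : Fin p) :
    eta (strength σ r p) ϑ r a (X.transpose * X) (V j).1 (V j).2 ≤ ϑ + r / 4 :=
  ((hV j).2 ({j}, ∅) (by simp [admissiblePairs])).trans
    (eta_singleton_le (strength_pos hσ hr hp) hϑ hr ha X (hX j))

lemma eta_le_rhoStar {p : ℕ} {τ ϑ r a : ℝ} {A : Matrix (Fin p) (Fin p) ℝ}
    {V : Fin p → Finset (Fin p) × Finset (Fin p)} (hV : IsLeastFavorable τ ϑ r a A V) (j : Fin p) :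
    eta τ ϑ r a A (V j).1 (V j).2 ≤ rhoStar τ ϑ r a A j := by
  refine le_csInf ⟨_, V j, (hV j).1, rfl⟩ ?_
  rintro _ ⟨W, hW, rfl⟩
  exact (hV j).2 W hW

/-! ### Testing a pair of least favorable signals -/

/-- The factor between the risk of testing a least favorable pair and `p ^ (-η)`, when `η ≤ C`. -/
noncomputable def testingFactor (C : ℝ) (p : ℕ) : ℝ :=
  (Real.sqrt (2 * Real.pi))⁻¹ * Real.exp (-(Real.sqrt (2 * C * Real.log p) + 1 / 2))

lemma testingFactor_mul_rpow_le {p : ℕ} (hp : 2 ≤ p) {ϑ C k x : ℝ}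
    (hC : x ^ 2 / 4 ≤ C) :
    testingFactor C p * (p : ℝ) ^ (-(k * ϑ + 1 / 4 * x ^ 2)) ≤
      (p : ℝ) ^ (-(k * ϑ)) * tailBound (Real.sqrt (2 * Real.log p) / 2 * x) := by
  have hp0 : (0 : ℝ) < p := by positivity
  have hlog : 0 < Real.log p := Real.log_pos (by exact_mod_cast hp)
  set l := Real.sqrt (2 * Real.log p) with hl
  have hl2 : l ^ 2 = 2 * Real.log p := Real.sq_sqrt (by positivity)
  have hlpos : 0 ≤ l := Real.sqrt_nonneg _
  have hs : l / 2 * x ≤ Real.sqrt (2 * C * Real.log p) := by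
    refine Real.le_sqrt_of_sq_le ?_
    rw [mul_pow, div_pow, hl2]
    nlinarith
  rw [testingFactor, tailBound, Real.rpow_def_of_pos hp0, Real.rpow_def_of_pos hp0, mul_left_comm,
    mul_assoc, ← Real.exp_add, ← Real.exp_add]
  refine mul_le_mul_of_nonneg_left (Real.exp_le_exp.2 ?_) (by positivity)
  -- The quadratic term produces the exponent of `p`; the linear term and `1 / 2` are what
  -- `testingFactor` absorbs.
  have : (l / 2 * x + 1) ^ 2 / 2 = Real.log p * (1 / 4 * x ^ 2) + l / 2 * x + 1 / 2 := by
    have : (l / 2 * x + 1) ^ 2 / 2 = l ^ 2 * (x ^ 2 / 8) + l / 2 * x + 1 / 2 := by ring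
    rw [this, hl2]; ring
  rw [neg_div, this]
  linarith

/-- Probability that `est` makes a sign error at some coordinate in `U`. -/
noncomputable def localErrorProb {n p : ℕ} (σ : ℝ) (X : Matrix (Fin n) (Fin p) ℝ)
    (est : (Fin n → ℝ) → Fin p → ℝ) (U : Finset (Fin p)) (β : Fin p → ℝ) : ℝ≥0∞ :=
  noiseLaw n {z | ∃ i ∈ U, SignType.sign (est (X *ᵥ β + σ • z) i) ≠ SignType.sign (β i)}

lemma measurableSet_sign_eq (c : SignType) : MeasurableSet {x : ℝ | SignType.sign x = c} := by
  rcases c with _ | _ | _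
  · convert measurableSet_singleton (0 : ℝ) using 1
    ext x
    exact sign_eq_zero_iff
  · convert measurableSet_Iio (a := (0 : ℝ)) using 1
    ext x
    exact sign_eq_neg_one_iff
  · convert measurableSet_Ioi (a := (0 : ℝ)) using 1
    ext x
    exact sign_eq_one_iff

lemma measurableSet_sign_agree {n p : ℕ} {est : (Fin n → ℝ) → Fin p → ℝ} (hest : Measurable est)
    (U : Finset (Fin p)) (θ : Fin p → ℝ) :
    MeasurableSet {y | ∀ i ∈ U, SignType.sign (est y i) = SignType.sign (θ i)} := by
  simp only [Set.ofPred_forall]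
  refine U.measurableSet_biInter fun i _ => ?_
  exact ((measurable_pi_apply i).comp hest) (measurableSet_sign_eq _)

/-- The distance of the two means is `√(2 log p) * √(α r)` and the log ratio of the weights is `(k₁
- k₀) ϑ log p`, so the testing threshold is `√(2 log p) / 2` times the bracket in `η` before its
positive part is taken. -/
lemma strength_le_of_le_card {n p : ℕ} {σ ϑ r : ℝ} (hσ : 0 < σ) (hr : 0 < r)
    (hp : 2 ≤ p) {α x s : ℝ} {k₀ k₁ : ℕ} (hk : k₀ ≤ k₁)
    (hx : x = max (Real.sqrt (α * r) - |(k₁ : ℝ) - k₀| * ϑ / Real.sqrt (α * r)) 0)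
    (hs : s = Real.sqrt (2 * Real.log p) / 2 * x) {h : Fin n → ℝ}
    (hh : h ⬝ᵥ h = (σ ^ 2)⁻¹ * ((strength σ r p) ^ 2 * α)) :
    Real.sqrt (h ⬝ᵥ h) / 2 - Real.log (sparsity ϑ p ^ k₀ / sparsity ϑ p ^ k₁) /
      Real.sqrt (h ⬝ᵥ h) ≤ s := by
  have hp0 : (0 : ℝ) < p := by positivity
  have hlog : 0 < Real.log p := Real.log_pos (by exact_mod_cast hp)
  set l := Real.sqrt (2 * Real.log p) with hl
  have hlpos : 0 < l := Real.sqrt_pos.2 (by positivity)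
  have hl2 : l * l = 2 * Real.log p := Real.mul_self_sqrt (by positivity)
  set D := Real.sqrt (α * r) with hD
  have h1 : Real.sqrt (h ⬝ᵥ h) = l * D := by
    rw [hl, hD, ← Real.sqrt_mul (by positivity), hh, strength, mul_pow,
      Real.sq_sqrt (by positivity)]
    congr 1
    field_simp
  have h2 : Real.log (sparsity ϑ p ^ k₀ / sparsity ϑ p ^ k₁) =
      |(k₁ : ℝ) - k₀| * ϑ * (l * l / 2) := by
    have hε : sparsity ϑ p ≠ 0 := (Real.rpow_pos_of_pos hp0 _).ne'
    rw [Real.log_div (pow_ne_zero _ hε) (pow_ne_zero _ hε), Real.log_pow, Real.log_pow, sparsity,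
      Real.log_rpow hp0, hl2, abs_of_nonneg (sub_nonneg.2 (by exact_mod_cast hk))]
    ring
  rw [h1, h2, hs, hx]
  calc l * D / 2 - |(k₁ : ℝ) - k₀| * ϑ * (l * l / 2) / (l * D)
      = l / 2 * (D - |(k₁ : ℝ) - k₀| * ϑ / D) := by
        rcases eq_or_ne D 0 with h0 | h0
        · simp [h0]
        · field_simp
    _ ≤ _ := by
        gcongr
        exact le_max_left _ _

/-- Weighted testing error for two signals `β₀`, `β₁`, the larger support being the second one. -/
lemma testingFactor_le_of_card_le {n p : ℕ} {σ ϑ r C α x : ℝ} (hσ : 0 < σ) (hϑ : 0 < ϑ)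
    (hr : 0 < r) (hp : 2 ≤ p) (X : Matrix (Fin n) (Fin p) ℝ) {k₀ k₁ : ℕ} (hk : k₀ ≤ k₁)
    (hx : x = max (Real.sqrt (α * r) - |(k₁ : ℝ) - k₀| * ϑ / Real.sqrt (α * r)) 0)
    (hC : x ^ 2 / 4 ≤ C) {β₀ β₁ : Fin p → ℝ}
    (hα : (X *ᵥ (β₁ - β₀)) ⬝ᵥ (X *ᵥ (β₁ - β₀)) = strength σ r p ^ 2 * α)
    {A : Set (Fin n → ℝ)} (hA : MeasurableSet A) :
    ENNReal.ofReal (testingFactor C p * (p : ℝ) ^ (-((k₁ : ℝ) * ϑ + 1 / 4 * x ^ 2))) ≤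
      ENNReal.ofReal (sparsity ϑ p ^ k₀) * noiseLaw n {z | X *ᵥ β₀ + σ • z ∈ A} +
      ENNReal.ofReal (sparsity ϑ p ^ k₁) * noiseLaw n {z | X *ᵥ β₁ + σ • z ∉ A} := by
  have hp0 : (0 : ℝ) < p := by positivity
  have hε : 0 < sparsity ϑ p := Real.rpow_pos_of_pos hp0 _
  have hε1 : sparsity ϑ p ≤ 1 :=
    Real.rpow_le_one_of_one_le_of_nonpos (by exact_mod_cast (by omega : 1 ≤ p)) (by linarith)
  have hx0 : 0 ≤ x := hx ▸ le_max_right _ _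
  set h : Fin n → ℝ := σ⁻¹ • (X *ᵥ (β₁ - β₀)) with hh
  have hhh : h ⬝ᵥ h = (σ ^ 2)⁻¹ * ((strength σ r p) ^ 2 * α) := by
    rw [hh, smul_dotProduct, dotProduct_smul, hα, smul_eq_mul, smul_eq_mul]
    field_simp
  have hB : MeasurableSet {z | X *ᵥ β₁ + σ • z ∈ A} := by
    have : Measurable fun z : Fin n → ℝ => X *ᵥ β₁ + σ • z := by fun_prop
    exact this hA
  -- Noise centered at `0` corresponds to `β₁`, the signal with the smaller weight; noise shifted by
  -- `-h` corresponds to `β₀`.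
  have hpre : (fun z => z - h) ⁻¹' {z | X *ᵥ β₁ + σ • z ∈ A} = {z | X *ᵥ β₀ + σ • z ∈ A} := by
    ext z
    have : X *ᵥ β₁ + σ • (z - h) = X *ᵥ β₀ + σ • z := by
      rw [hh, smul_sub, smul_smul, mul_inv_cancel₀ hσ.ne', one_smul, Matrix.mulVec_sub]
      abel
    simp only [Set.mem_preimage, Set.mem_ofPred_eq, this]
  have h1 := le_testing_error h (pow_pos hε k₁) (pow_le_pow_of_le_one hε.le hε1 hk)
    (s := Real.sqrt (2 * Real.log p) / 2 * x) (by positivity)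
    (strength_le_of_le_card hσ hr hp hk hx rfl hhh) hB
  rw [hpre] at h1
  refine le_trans (ENNReal.ofReal_le_ofReal ?_) h1
  refine (testingFactor_mul_rpow_le hp hC).trans (le_of_eq ?_)
  congr 1
  rw [sparsity, ← Real.rpow_natCast, ← Real.rpow_mul hp0.le]
  ring_nf

/-- Weighted testing error for a pair `β₀`, `β₁` realizing `α^*(V₀, V₁)`. -/
lemma testingFactor_le {n p : ℕ} {σ ϑ r a C : ℝ} (hσ : 0 < σ) (hϑ : 0 < ϑ)
    (hr : 0 < r) (hp : 2 ≤ p) (X : Matrix (Fin n) (Fin p) ℝ) {V₀ V₁ : Finset (Fin p)}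
    (hC : eta (strength σ r p) ϑ r a (X.transpose * X) V₀ V₁ ≤ C) {β₀ β₁ : Fin p → ℝ}
    (hα : (X *ᵥ (β₁ - β₀)) ⬝ᵥ (X *ᵥ (β₁ - β₀)) =
      strength σ r p ^ 2 * alphaStar (strength σ r p) a (X.transpose * X) V₀ V₁)
    {A : Set (Fin n → ℝ)} (hA : MeasurableSet A) :
    ENNReal.ofReal (testingFactor C p *
        (p : ℝ) ^ (-eta (strength σ r p) ϑ r a (X.transpose * X) V₀ V₁)) ≤
      ENNReal.ofReal (sparsity ϑ p ^ V₀.card) * noiseLaw n {z | X *ᵥ β₀ + σ • z ∈ A} +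
      ENNReal.ofReal (sparsity ϑ p ^ V₁.card) * noiseLaw n {z | X *ᵥ β₁ + σ • z ∉ A} := by
  set α := alphaStar (strength σ r p) a (X.transpose * X) V₀ V₁ with hα'
  have hC' : (max (Real.sqrt (α * r) -
      |(V₁.card : ℝ) - (V₀.card : ℝ)| * ϑ / Real.sqrt (α * r)) 0) ^ 2 / 4 ≤ C := by
    refine le_trans ?_ hC
    rw [eta]
    have : 0 ≤ max (V₀.card : ℝ) (V₁.card : ℝ) * ϑ := by positivity
    linarith
  rcases le_total V₀.card V₁.card with hk | hk
  · have := testingFactor_le_of_card_le hσ hϑ hr hp X hk rfl hC' hα hA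
    rwa [eta, max_eq_right (by exact_mod_cast hk)]
  · rw [abs_sub_comm] at hC'
    have hα₂ : (X *ᵥ (β₀ - β₁)) ⬝ᵥ (X *ᵥ (β₀ - β₁)) = strength σ r p ^ 2 * α := by
      rw [← hα, ← neg_sub β₁ β₀, Matrix.mulVec_neg, neg_dotProduct_neg]
    -- With the larger support first, the hypotheses exchange roles and the decision region becomes
    -- its complement.
    have := testingFactor_le_of_card_le hσ hϑ hr hp X hk rfl hC' hα₂ hA.compl
    rw [eta, max_eq_left (by exact_mod_cast hk), abs_sub_comm, add_comm (ENNReal.ofReal _ * _)]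
    simpa only [Set.mem_compl_iff, not_not] using this

/-- Local version: the error probabilities at coordinates in `V₀ ∪ V₁` of two signals that are
there a least favorable pair and coincide elsewhere. -/
lemma testingFactor_le_localErrorProb {n p : ℕ} {σ ϑ r a C : ℝ} (hσ : 0 < σ) (hϑ : 0 < ϑ)
    (hr : 0 < r) (hp : 2 ≤ p) (X : Matrix (Fin n) (Fin p) ℝ) {V₀ V₁ : Finset (Fin p)}
    (hC : eta (strength σ r p) ϑ r a (X.transpose * X) V₀ V₁ ≤ C) {β₀ β₁ θ₀ θ₁ : Fin p → ℝ}
    (hθ₀ : θ₀ ∈ supportedSignals (strength σ r p) a V₀)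
    (hθ₁ : θ₁ ∈ supportedSignals (strength σ r p) a V₁)
    (hne : ∃ i, SignType.sign (θ₀ i) ≠ SignType.sign (θ₁ i))
    (hα : alphaStar (strength σ r p) a (X.transpose * X) V₀ V₁ =
      alpha (strength σ r p) (X.transpose * X) θ₀ θ₁)
    (h₀ : ∀ i ∈ V₀ ∪ V₁, β₀ i = θ₀ i) (h₁ : ∀ i ∈ V₀ ∪ V₁, β₁ i = θ₁ i)
    (hout : ∀ i ∉ V₀ ∪ V₁, β₀ i = β₁ i)
    {est : (Fin n → ℝ) → Fin p → ℝ} (hest : Measurable est) :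
    ENNReal.ofReal (testingFactor C p *
        (p : ℝ) ^ (-eta (strength σ r p) ϑ r a (X.transpose * X) V₀ V₁)) ≤
      ENNReal.ofReal (sparsity ϑ p ^ V₀.card) * localErrorProb σ X est (V₀ ∪ V₁) β₀ +
      ENNReal.ofReal (sparsity ϑ p ^ V₁.card) * localErrorProb σ X est (V₀ ∪ V₁) β₁ := by
  have hτ := strength_pos hσ hr hp
  have hz : ∀ i ∉ V₀ ∪ V₁, θ₀ i = 0 ∧ θ₁ i = 0 := fun i hi => by
    rw [Finset.mem_union, not_or] at hi
    exact ⟨apply_of_notMem_of_mem_supportedSignals hθ₀ hi.1,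
      apply_of_notMem_of_mem_supportedSignals hθ₁ hi.2⟩
  have hdiff : β₁ - β₀ = θ₁ - θ₀ := by
    ext i
    by_cases hi : i ∈ V₀ ∪ V₁
    · simp [h₀ i hi, h₁ i hi]
    · simp [hout i hi, hz i hi]
  have hα' : (X *ᵥ (β₁ - β₀)) ⬝ᵥ (X *ᵥ (β₁ - β₀)) =
      strength σ r p ^ 2 * alphaStar (strength σ r p) a (X.transpose * X) V₀ V₁ := by
    rw [hα, alpha_transpose_mul, hdiff, ← neg_sub θ₀ θ₁, Matrix.mulVec_neg, neg_dotProduct_neg,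
      mul_inv_cancel_left₀ (by positivity)]
  -- The test decides for `θ₁` when the estimate has its signs on all of `V₀ ∪ V₁`. A wrong decision
  -- under either signal forces a sign error there.
  refine (testingFactor_le hσ hϑ hr hp X hC hα'
    (measurableSet_sign_agree hest (V₀ ∪ V₁) θ₁)).trans ?_
  unfold localErrorProb
  gcongr ENNReal.ofReal (sparsity ϑ p ^ V₀.card) * noiseLaw n ?_ +
    ENNReal.ofReal (sparsity ϑ p ^ V₁.card) * noiseLaw n ?_
  · intro z hzA
    obtain ⟨i, hi⟩ := hne
    have hiU : i ∈ V₀ ∪ V₁ := by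
      by_contra h
      exact hi (by rw [(hz i h).1, (hz i h).2])
    refine ⟨i, hiU, ?_⟩
    rw [h₀ i hiU]
    exact fun h => hi (h.symm.trans (hzA i hiU))
  · intro z hzA
    simp only [Set.mem_ofPred_eq, not_forall] at hzA ⊢
    obtain ⟨i, hi, hne⟩ := hzA
    exact ⟨i, hi, by rwa [h₁ i hi]⟩

/-- Since `η` contains `max(|V₀|, |V₁|) ϑ`, the union has bounded size, and requiring `b = 0` on the
rest of it costs only a constant factor. -/
lemma card_union_le_of_eta_le {p : ℕ} {τ ϑ r a C : ℝ} (hϑ : 0 < ϑ)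
    {A : Matrix (Fin p) (Fin p) ℝ} {V₀ V₁ : Finset (Fin p)} (hC : eta τ ϑ r a A V₀ V₁ ≤ C) :
    (V₀ ∪ V₁).card ≤ ⌊2 * C / ϑ⌋₊ := by
  refine Nat.le_floor ?_
  have h1 : max (V₀.card : ℝ) (V₁.card : ℝ) * ϑ ≤ C := by
    refine le_trans ?_ hC
    rw [eta]
    exact le_add_of_nonneg_right (by positivity)
  have h2 : ((V₀ ∪ V₁).card : ℝ) ≤ V₀.card + V₁.card := by
    exact_mod_cast Finset.card_union_le _ _
  rw [le_div_iff₀ hϑ]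
  nlinarith [le_max_left (V₀.card : ℝ) (V₁.card : ℝ), le_max_right (V₀.card : ℝ) (V₁.card : ℝ)]

/-- Local Bayes risk over the rare signals `b ∘ μ` and `b ∘ μ'`. -/
lemma le_lintegral_localErrorProb_add {n p : ℕ} {σ ϑ r a C : ℝ} (hσ : 0 < σ) (hϑ : 0 < ϑ)
    (hr : 0 < r) (hp : 2 ≤ p) (X : Matrix (Fin n) (Fin p) ℝ) {V₀ V₁ : Finset (Fin p)}
    (hC : eta (strength σ r p) ϑ r a (X.transpose * X) V₀ V₁ ≤ C) {μ μ' θ₀ θ₁ : Fin p → ℝ}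
    (hθ₀ : θ₀ ∈ supportedSignals (strength σ r p) a V₀)
    (hθ₁ : θ₁ ∈ supportedSignals (strength σ r p) a V₁)
    (hne : ∃ i, SignType.sign (θ₀ i) ≠ SignType.sign (θ₁ i))
    (hα : alphaStar (strength σ r p) a (X.transpose * X) V₀ V₁ =
      alpha (strength σ r p) (X.transpose * X) θ₀ θ₁)
    (h₀ : ∀ i ∈ V₀, μ i = θ₀ i) (h₁ : ∀ i ∈ V₁, μ' i = θ₁ i)
    (hout : ∀ i ∉ V₀ ∪ V₁, μ i = μ' i)
    {est : (Fin n → ℝ) → Fin p → ℝ} (hest : Measurable est) :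
    ENNReal.ofReal ((1 - 2 ^ (-ϑ)) ^ ⌊2 * C / ϑ⌋₊ * (testingFactor C p *
        (p : ℝ) ^ (-eta (strength σ r p) ϑ r a (X.transpose * X) V₀ V₁))) ≤
      ∫⁻ b, localErrorProb σ X est (V₀ ∪ V₁) (b * μ) ∂(bernoulliLaw p (sparsity ϑ p)) +
      ∫⁻ b, localErrorProb σ X est (V₀ ∪ V₁) (b * μ') ∂(bernoulliLaw p (sparsity ϑ p)) := by
  have hp0 : (0 : ℝ) < p := by positivity
  set ε := sparsity ϑ p with hεdef
  have hε0 : 0 < ε := Real.rpow_pos_of_pos hp0 _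
  have hε2 : ε ≤ 2 ^ (-ϑ) :=
    Real.rpow_le_rpow_of_nonpos two_pos (by exact_mod_cast hp) (by linarith)
  have h21 : (2 : ℝ) ^ (-ϑ) ≤ 1 := Real.rpow_le_one_of_one_le_of_nonpos one_le_two (by linarith)
  have hε1 : ε ≤ 1 := hε2.trans h21
  set U := V₀ ∪ V₁ with hU
  set q : ℝ := (1 - 2 ^ (-ϑ)) ^ ⌊2 * C / ϑ⌋₊ with hq
  have hq0 : 0 ≤ q := pow_nonneg (sub_nonneg.2 h21) _
  have hcard : U.card ≤ ⌊2 * C / ϑ⌋₊ := card_union_le_of_eta_le hϑ hC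
  have hpat : ∀ V : Finset (Fin p), q * ε ^ V.card ≤ patternProb ε U V := fun V => by
    rw [patternProb, mul_comm]
    refine mul_le_mul_of_nonneg_left ?_ (pow_nonneg hε0.le _)
    calc q ≤ (1 - ε) ^ ⌊2 * C / ϑ⌋₊ := pow_le_pow_left₀ (sub_nonneg.2 h21) (by linarith) _
      _ ≤ _ := pow_le_pow_of_le_one (by linarith) (by linarith) (by omega)
  have hpat' : ∀ V : Finset (Fin p), ENNReal.ofReal q * ENNReal.ofReal (ε ^ V.card) ≤
      ENNReal.ofReal (patternProb ε U V) := fun V => by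
    rw [← ENNReal.ofReal_mul hq0]
    exact ENNReal.ofReal_le_ofReal (hpat V)
  set t := testingFactor C p *
    (p : ℝ) ^ (-eta (strength σ r p) ϑ r a (X.transpose * X) V₀ V₁) with ht
  set F := localErrorProb σ X est U with hF
  refine le_trans ?_ (add_le_add
    (sum_patternProb_compl_le_lintegral hε0.le hε1 (fun b => F (b * μ))
      (U := U) Finset.subset_union_left)
    (sum_patternProb_compl_le_lintegral hε0.le hε1 (fun b => F (b * μ'))
      (U := U) Finset.subset_union_right))
  rw [← Finset.sum_add_distrib]
  have hone : ∑ W ∈ Uᶜ.powerset, ENNReal.ofReal (patternProb ε Uᶜ W) = 1 := by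
    rw [← ENNReal.ofReal_sum_of_nonneg fun W _ => patternProb_nonneg hε0.le hε1 _ _,
      sum_patternProb, ENNReal.ofReal_one]
  -- Condition on the support `W` of `b` outside `U`: for each `W` the two signals agree off `U`, so
  -- the local test applies, and the probabilities of the `W` sum to `1`.
  calc ENNReal.ofReal (q * t)
      = ∑ W ∈ Uᶜ.powerset, ENNReal.ofReal (patternProb ε Uᶜ W) * ENNReal.ofReal (q * t) := by
        rw [← Finset.sum_mul, hone, one_mul]
    _ ≤ _ := by
      refine Finset.sum_le_sum fun W hW => ?_
      rw [← mul_add]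
      gcongr
      have hWU : ∀ i ∈ U, i ∉ W := fun i hi hiW =>
        Finset.mem_compl.1 (Finset.mem_powerset.1 hW hiW) hi
      have key := testingFactor_le_localErrorProb hσ hϑ hr hp X hC
        (β₀ := ((W ∪ V₀ : Finset (Fin p)) : Set (Fin p)).indicator 1 * μ)
        (β₁ := ((W ∪ V₁ : Finset (Fin p)) : Set (Fin p)).indicator 1 * μ')
        hθ₀ hθ₁ hne hα ?_ ?_ ?_ hest
      · rw [ENNReal.ofReal_mul hq0]
        refine (mul_le_mul_right key _).trans ?_
        rw [mul_add, ← mul_assoc, ← mul_assoc]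
        gcongr
        · exact hpat' V₀
        · exact hpat' V₁
      · intro i hi
        by_cases hi0 : i ∈ V₀
        · simp [hi0, h₀ i hi0]
        · simp [hi0, hWU i hi, apply_of_notMem_of_mem_supportedSignals hθ₀ hi0]
      · intro i hi
        by_cases hi0 : i ∈ V₁
        · simp [hi0, h₁ i hi0]
        · simp [hi0, hWU i hi, apply_of_notMem_of_mem_supportedSignals hθ₁ hi0]
      · intro i hi
        have hi' := hi
        rw [Finset.mem_union, not_or] at hi'
        by_cases hiW : i ∈ W
        · simp [hiW, hout i hi]
        · simp [hiW, hi'.1, hi'.2]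

/-! ### From local to global risk -/

/-- A graph with degrees at most `d` (loops included) has an independent set that carries at least
a fraction `1 / d` of the total weight. -/
lemma exists_independent_sum_le {ι : Type*} [Fintype ι] [DecidableEq ι] (adj : ι → ι → Prop)
    [DecidableRel adj] (hrefl : ∀ i, adj i i) (hsymm : ∀ i j, adj i j → adj j i) {d : ℕ}
    (hd : ∀ j, (Finset.univ.filter fun k => adj j k).card ≤ d) {w : ι → ℝ} (hw : ∀ i, 0 ≤ w i) :
    ∃ J : Finset ι, (∀ j ∈ J, ∀ k ∈ J, adj j k → j = k) ∧ ∑ i, w i ≤ d * ∑ j ∈ J, w j := by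
  suffices h : ∀ S : Finset ι, ∃ J ⊆ S, (∀ j ∈ J, ∀ k ∈ J, adj j k → j = k) ∧
      ∑ i ∈ S, w i ≤ d * ∑ j ∈ J, w j by
    obtain ⟨J, -, hJ⟩ := h Finset.univ
    exact ⟨J, hJ⟩
  intro S
  induction S using Finset.strongInduction with
  | H S ih =>
    rcases S.eq_empty_or_nonempty with rfl | hS
    · exact ⟨∅, subset_rfl, by simp, by simp⟩
    · obtain ⟨m, hm, hmax⟩ := S.exists_max_image w hS
      obtain ⟨J, hJS, hJ, hsum⟩ := ih (S.filter fun k => ¬ adj m k)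
        (Finset.filter_ssubset.2 ⟨m, hm, not_not.2 (hrefl m)⟩)
      have hmJ : ∀ k ∈ J, ¬ adj m k := fun k hk => (Finset.mem_filter.1 (hJS hk)).2
      refine ⟨insert m J, Finset.insert_subset hm (hJS.trans (Finset.filter_subset _ _)), ?_, ?_⟩
      · intro j hj k hk hjk
        rcases Finset.mem_insert.1 hj with rfl | hj' <;> rcases Finset.mem_insert.1 hk with rfl | hk'
        · rfl
        · exact absurd hjk (hmJ k hk')
        · exact absurd (hsymm _ _ hjk) (hmJ j hj')
        · exact hJ j hj' k hk' hjk
      · have hm' : m ∉ J := fun h => hmJ m h (hrefl m)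
        rw [Finset.sum_insert hm', mul_add, ← Finset.sum_filter_add_sum_filter_not S (adj m)]
        refine add_le_add ?_ hsum
        calc ∑ i ∈ S.filter (adj m), w i ≤ (S.filter (adj m)).card • w m :=
              Finset.sum_le_card_nsmul _ _ _ fun i hi => hmax i (Finset.mem_filter.1 hi).1
          _ ≤ d * w m := by
              rw [nsmul_eq_mul]
              refine mul_le_mul_of_nonneg_right ?_ (hw m)
              exact_mod_cast (Finset.card_le_card
                (Finset.filter_subset_filter _ (Finset.subset_univ S))).trans (hd m)

/-- Superadditivity of the lower integral holds for arbitrary functions, so measurability of the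
risk in `b` is never needed. -/
lemma sum_lintegral_le_lintegral_sum {Ω ι : Type*} [MeasurableSpace Ω] (P : Measure Ω)
    (J : Finset ι) (f : ι → Ω → ℝ≥0∞) :
    ∑ j ∈ J, ∫⁻ x, f j x ∂P ≤ ∫⁻ x, ∑ j ∈ J, f j x ∂P := by
  classical
  induction J using Finset.induction_on with
  | empty => simp
  | insert j J hj ih =>
    simp only [Finset.sum_insert hj]
    exact (add_le_add le_rfl ih).trans (le_lintegral_add _ _)

lemma sum_localErrorProb_le_hammingRisk {n p : ℕ} (σ : ℝ) (X : Matrix (Fin n) (Fin p) ℝ)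
    {est : (Fin n → ℝ) → Fin p → ℝ} (hest : Measurable est) {J : Finset (Fin p)}
    {U : Fin p → Finset (Fin p)} (hU : (J : Set (Fin p)).PairwiseDisjoint U) (β : Fin p → ℝ) :
    ∑ j ∈ J, localErrorProb σ X est (U j) β ≤ hammingRisk σ X est β := by
  classical
  set S : Fin p → Set (Fin n → ℝ) := fun j =>
    {z | ∃ i ∈ U j, SignType.sign (est (X *ᵥ β + σ • z) i) ≠ SignType.sign (β i)} with hS
  have hmeas : ∀ j, MeasurableSet (S j) := fun j => by
    have h1 : Measurable fun z : Fin n → ℝ => X *ᵥ β + σ • z := by fun_prop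
    have h2 := (h1 (measurableSet_sign_agree hest (U j) β)).compl
    convert h2 using 1
    ext z
    simp [hS]
  calc ∑ j ∈ J, localErrorProb σ X est (U j) β
      = ∑ j ∈ J, ∫⁻ z, (S j).indicator 1 z ∂(noiseLaw n) := by
        simp_rw [lintegral_indicator_one (hmeas _)]
        rfl
    _ ≤ ∫⁻ z, ∑ j ∈ J, (S j).indicator 1 z ∂(noiseLaw n) := sum_lintegral_le_lintegral_sum _ _ _
    _ ≤ hammingRisk σ X est β := by
        refine lintegral_mono fun z => ?_
        set T : Finset (Fin p) := Finset.univ.filter fun i =>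
          SignType.sign (est (X *ᵥ β + σ • z) i) ≠ SignType.sign (β i) with hT
        have h1 : ∑ j ∈ J, (T ∩ U j).card ≤ T.card := by
          rw [← Finset.card_biUnion]
          · exact Finset.card_le_card (Finset.biUnion_subset.2 fun j _ => Finset.inter_subset_left)
          · intro j hj k hk hjk
            exact Finset.disjoint_of_subset_left Finset.inter_subset_right
              (Finset.disjoint_of_subset_right Finset.inter_subset_right (hU hj hk hjk))
        have h2 : ∀ j ∈ J, (S j).indicator (1 : (Fin n → ℝ) → ℝ≥0∞) z ≤ ((T ∩ U j).card : ℝ≥0∞) := by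
          intro j _
          by_cases hz : z ∈ S j
          · rw [Set.indicator_of_mem hz, Pi.one_apply]
            obtain ⟨i, hi, hne⟩ := hz
            have : 0 < (T ∩ U j).card :=
              Finset.card_pos.2 ⟨i, Finset.mem_inter.2 ⟨by simp [hT, hne], hi⟩⟩
            exact_mod_cast this
          · rw [Set.indicator_of_notMem hz]
            exact zero_le
        refine (Finset.sum_le_sum h2).trans ?_
        rw [← Nat.cast_sum]
        exact Nat.cast_le.2 h1

lemma sum_lintegral_localErrorProb_le_bayesHammingRisk {n p : ℕ} (σ ε : ℝ)
    (X : Matrix (Fin n) (Fin p) ℝ) {est : (Fin n → ℝ) → Fin p → ℝ} (hest : Measurable est)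
    {J : Finset (Fin p)} {U : Fin p → Finset (Fin p)}
    (hU : (J : Set (Fin p)).PairwiseDisjoint U) (μ : Fin p → ℝ) :
    ∑ j ∈ J, ∫⁻ b, localErrorProb σ X est (U j) (b * μ) ∂(bernoulliLaw p ε) ≤
      bayesHammingRisk σ ε X est μ :=
  (sum_lintegral_le_lintegral_sum _ _ _).trans
    (lintegral_mono fun _ => sum_localErrorProb_le_hammingRisk σ X hest hU _)

/-- Averaging over independent fair choices `s j`, when each pair of choices at `j` has joint
contribution at least `c j`. -/
lemma sum_le_two_mul_of_forall_flip {ι : Type*} [Fintype ι] [DecidableEq ι] (J : Finset ι)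
    (R : ι → (ι → Bool) → ℝ≥0∞) (c : ι → ℝ≥0∞) {S : ℝ≥0∞} (hS : ∀ s, ∑ j ∈ J, R j s ≤ S)
    (hc : ∀ j ∈ J, ∀ s, s j = false → c j ≤ R j s + R j (Function.update s j true)) :
    ∑ j ∈ J, c j ≤ 2 * S := by
  -- Flipping coin `j` permutes the coin sequences, so both terms of the pair have the same sum over
  -- `s`; this is the source of the factor `2`.
  have hflip : ∀ j : ι, Function.Involutive fun s : ι → Bool => Function.update s j (!(s j)) := by
    intro j s
    simp
  have hpair : ∀ j ∈ J, ∀ s, c j ≤ R j s + R j (Function.update s j (!(s j))) := by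
    intro j hj s
    cases hsj : s j with
    | false => simpa using hc j hj s hsj
    | true =>
      have := hc j hj (Function.update s j false) (by simp)
      rw [Function.update_idem, ← hsj, Function.update_eq_self, add_comm] at this
      simpa [hsj] using this
  set N : ℝ≥0∞ := (Fintype.card (ι → Bool) : ℝ≥0∞) with hN
  have h1 : ∀ j ∈ J, N * c j ≤ 2 * ∑ s, R j s := by
    intro j hj
    have h := Finset.sum_le_sum fun s (_ : s ∈ Finset.univ) => hpair j hj s
    rw [Finset.sum_const, Finset.card_univ, nsmul_eq_mul, Finset.sum_add_distrib,
      show ∑ s, R j (Function.update s j (!(s j))) = ∑ s, R j s from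
        Equiv.sum_comp (hflip j).toPerm (R j), ← two_mul] at h
    exact h
  have h2 : N * ∑ j ∈ J, c j ≤ N * (2 * S) := by
    calc N * ∑ j ∈ J, c j ≤ ∑ j ∈ J, 2 * ∑ s, R j s := by
          rw [Finset.mul_sum]
          exact Finset.sum_le_sum h1
      _ = 2 * ∑ s, ∑ j ∈ J, R j s := by rw [← Finset.mul_sum, Finset.sum_comm]
      _ ≤ 2 * ∑ s : ι → Bool, S := by gcongr with s; exact hS s
      _ = N * (2 * S) := by
          rw [Finset.sum_const, Finset.card_univ, nsmul_eq_mul]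
          ring
  exact (ENNReal.mul_le_mul_iff_right (by simp [hN]) (by simp [hN])).1 h2

/-- The pieces `μ₀ j` or `μ₁ j`, according to `s j`, on the sets `U j`, `j ∈ J`, and `ν` elsewhere. -/
noncomputable def gluedSignal {p : ℕ} (J : Finset (Fin p)) (U : Fin p → Finset (Fin p))
    (μ₀ μ₁ : Fin p → Fin p → ℝ) (ν : Fin p → ℝ) (s : Fin p → Bool) : Fin p → ℝ := fun i =>
  open Classical in
  if h : ∃ j ∈ J, i ∈ U j then (if s h.choose then μ₁ h.choose i else μ₀ h.choose i) else ν i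

/-- Disjointness makes the index picked by `choose` unique. -/
lemma gluedSignal_apply_of_mem {p : ℕ} {J : Finset (Fin p)} {U : Fin p → Finset (Fin p)}
    (hU : (J : Set (Fin p)).PairwiseDisjoint U) (μ₀ μ₁ : Fin p → Fin p → ℝ) (ν : Fin p → ℝ)
    (s : Fin p → Bool) {i j : Fin p} (hj : j ∈ J) (hi : i ∈ U j) :
    gluedSignal J U μ₀ μ₁ ν s i = if s j then μ₁ j i else μ₀ j i := by
  have h : ∃ j ∈ J, i ∈ U j := ⟨j, hj, hi⟩
  have hch : h.choose = j := by
    by_contra hne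
    exact Finset.disjoint_left.1 (hU h.choose_spec.1 hj hne) h.choose_spec.2 hi
  rw [gluedSignal, dif_pos h, hch]

lemma gluedSignal_update_apply_of_notMem {p : ℕ} {J : Finset (Fin p)} {U : Fin p → Finset (Fin p)}
    (μ₀ μ₁ : Fin p → Fin p → ℝ) (ν : Fin p → ℝ)
    (s : Fin p → Bool) (x : Bool) {i j : Fin p} (hi : i ∉ U j) :
    gluedSignal J U μ₀ μ₁ ν (Function.update s j x) i = gluedSignal J U μ₀ μ₁ ν s i := by
  by_cases h : ∃ j ∈ J, i ∈ U j
  · have hne : h.choose ≠ j := fun hch => hi (hch ▸ h.choose_spec.2)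
    simp only [gluedSignal, dif_pos h, Function.update_of_ne hne]
  · simp only [gluedSignal, dif_neg h]

lemma gluedSignal_mem_signalSet {p : ℕ} {J : Finset (Fin p)} {U : Fin p → Finset (Fin p)}
    {μ₀ μ₁ : Fin p → Fin p → ℝ} {ν : Fin p → ℝ} {τ a : ℝ} (h₀ : ∀ j, μ₀ j ∈ signalSet p τ a)
    (h₁ : ∀ j, μ₁ j ∈ signalSet p τ a) (hν : ν ∈ signalSet p τ a) (s : Fin p → Bool) :
    gluedSignal J U μ₀ μ₁ ν s ∈ signalSet p τ a := by
  have key : ∀ i, ∃ μ ∈ signalSet p τ a, gluedSignal J U μ₀ μ₁ ν s i = μ i := by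
    intro i
    unfold gluedSignal
    split_ifs with h h'
    · exact ⟨_, h₁ _, rfl⟩
    · exact ⟨_, h₀ _, rfl⟩
    · exact ⟨_, hν, rfl⟩
  constructor <;> intro i <;> obtain ⟨μ, hμ, hi⟩ := key i <;> rw [hi]
  · exact hμ.1 i
  · exact hμ.2 i

/-- Lower bound for the minimax Hamming distance from disjoint least favorable pairs. -/
lemma sum_le_two_mul_minimaxHamming {n p : ℕ} {σ ϑ r a C : ℝ} (hσ : 0 < σ) (hϑ : 0 < ϑ)
    (hr : 0 < r) (ha : 1 ≤ a) (hp : 2 ≤ p) (X : Matrix (Fin n) (Fin p) ℝ)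
    {V : Fin p → Finset (Fin p) × Finset (Fin p)} (hV : ∀ j, V j ∈ admissiblePairs j)
    (hC : ∀ j, eta (strength σ r p) ϑ r a (X.transpose * X) (V j).1 (V j).2 ≤ C)
    {J : Finset (Fin p)}
    (hJ : (J : Set (Fin p)).PairwiseDisjoint fun j => (V j).1 ∪ (V j).2) :
    ∑ j ∈ J, ENNReal.ofReal ((1 - 2 ^ (-ϑ)) ^ ⌊2 * C / ϑ⌋₊ * (testingFactor C p *
        (p : ℝ) ^ (-eta (strength σ r p) ϑ r a (X.transpose * X) (V j).1 (V j).2))) ≤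
      2 * minimaxHamming σ ϑ r a X := by
  have hτ := strength_pos hσ hr hp
  choose θ₀ hθ₀ θ₁ hθ₁ hne hα using fun j =>
    exists_alpha_eq_alphaStar hτ ha (X.transpose * X) (hV j)
  choose μ₀ hμ₀ hμθ₀ using hθ₀
  choose μ₁ hμ₁ hμθ₁ using hθ₁
  rw [minimaxHamming]
  simp only [ENNReal.mul_iInf_of_ne two_ne_zero ENNReal.ofNat_ne_top]
  refine le_iInf₂ fun est hest => ?_
  set U : Fin p → Finset (Fin p) := fun j => (V j).1 ∪ (V j).2 with hU
  set M := gluedSignal J U μ₀ μ₁ (fun _ => strength σ r p) with hM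
  refine sum_le_two_mul_of_forall_flip J (fun j s => ∫⁻ b, localErrorProb σ X est (U j) (b * M s)
    ∂(bernoulliLaw p (sparsity ϑ p))) _ (fun s => ?_) (fun j hj s hs => ?_)
  · refine (sum_lintegral_localErrorProb_le_bayesHammingRisk σ _ X hest hJ (M s)).trans ?_
    exact le_iSup₂ (f := fun μ (_ : μ ∈ signalSet p (strength σ r p) a) =>
      bayesHammingRisk σ (sparsity ϑ p) X est μ) (M s) (gluedSignal_mem_signalSet hμ₀ hμ₁
      (const_mem_signalSet hτ.le ha (abs_of_pos hτ)) s)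
  · refine le_lintegral_localErrorProb_add hσ hϑ hr hp X (hC j) ⟨_, hμ₀ j, hμθ₀ j⟩
      ⟨_, hμ₁ j, hμθ₁ j⟩ (hne j) (hα j) (fun i hi => ?_) (fun i hi => ?_) (fun i hi => ?_) hest
    · rw [hM, gluedSignal_apply_of_mem hJ _ _ _ _ hj (Finset.mem_union_left _ hi), ← hμθ₀ j]
      simp [hs, hi]
    · rw [hM, gluedSignal_apply_of_mem hJ _ _ _ _ hj (Finset.mem_union_right _ hi), ← hμθ₁ j]
      simp [hi]
    · exact (gluedSignal_update_apply_of_notMem _ _ _ _ _ hi).symm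

/-! ### The multi-logarithmic factor -/

lemma isMultiLog_const_mul_testingFactor {c C : ℝ} (hc : 0 < c) (hC : 0 ≤ C) :
    IsMultiLog fun p => c * testingFactor C p := by
  have hlog : Tendsto (fun p : ℕ => Real.log p) atTop atTop :=
    Real.tendsto_log_atTop.comp tendsto_natCast_atTop_atTop
  set k := c * (Real.sqrt (2 * Real.pi))⁻¹ with hk
  have hkpos : 0 < k := by positivity
  refine ⟨fun p => by unfold testingFactor; positivity, fun δ hδ => ⟨?_, ?_⟩⟩
  · have hsqrt : Tendsto (fun p : ℕ => Real.sqrt (Real.log p)) atTop atTop :=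
      Real.tendsto_sqrt_atTop.comp hlog
    -- This is the exponent of `testingFactor C p * p ^ δ`: the term `δ log p` beats `√(2 C log p)`.
    have h1 : Tendsto (fun p : ℕ => Real.sqrt (Real.log p) *
        (δ * Real.sqrt (Real.log p) - Real.sqrt (2 * C)) + -(1 / 2)) atTop atTop :=
      tendsto_atTop_add_const_right _ _ (hsqrt.atTop_mul_atTop₀
        (tendsto_atTop_add_const_right _ _ (hsqrt.const_mul_atTop hδ)))
    refine ((Real.tendsto_exp_atTop.comp h1).const_mul_atTop hkpos).congr' ?_
    filter_upwards [eventually_ge_atTop 1] with p hp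
    have hp0 : (0 : ℝ) < p := by exact_mod_cast hp
    have hl : 0 ≤ Real.log p := Real.log_nonneg (by exact_mod_cast hp)
    simp only [Function.comp_apply]
    rw [testingFactor, Real.rpow_def_of_pos hp0, ← mul_assoc, mul_assoc (c * _), ← Real.exp_add,
      Real.sqrt_mul (by positivity : 0 ≤ 2 * C)]
    congr 2
    linear_combination δ * Real.mul_self_sqrt hl
  · have h1 : Tendsto (fun p : ℕ => k * (p : ℝ) ^ (-δ)) atTop (𝓝 0) := by
      simpa using ((tendsto_rpow_neg_atTop hδ).comp tendsto_natCast_atTop_atTop).const_mul k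
    refine squeeze_zero (fun p => by unfold testingFactor; positivity) (fun p => ?_) h1
    refine mul_le_mul_of_nonneg_right ?_ (by positivity)
    change c * testingFactor C p ≤ k
    rw [testingFactor, ← mul_assoc]
    refine mul_le_of_le_one_right hkpos.le (Real.exp_le_one_iff.2 ?_)
    have := Real.sqrt_nonneg (2 * C * Real.log p)
    linarith

end GolfBound

/-! ### The lower bound for the minimax Hamming distance -/

theorem corollary1 (σ ϑ r a c₀ : ℝ) (m₀ : ℕ) (hσ : 0 < σ) (hϑ₀ : 0 < ϑ) (hϑ₁ : ϑ < 1)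
    (hr : 0 < r) (ha : 1 ≤ a) (hc₀ : 0 < c₀) (hm₀ : 1 ≤ m₀) :
    ∃ L : ℕ → ℝ, GolfBound.IsMultiLog L ∧
      ∀ᶠ p : ℕ in Filter.atTop, ∀ (n : ℕ) (X : Matrix (Fin n) (Fin p) ℝ),
        X.transpose * X ∈ GolfBound.correlationClass p c₀ (GolfBound.gParam m₀ ϑ r) →
        ∀ V : Fin p → Finset (Fin p) × Finset (Fin p),
          GolfBound.IsLeastFavorable (GolfBound.strength σ r p) ϑ r a (X.transpose * X) V →
          ENNReal.ofReal (L p * (GolfBound.golfDegree V : ℝ)⁻¹ *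
              ∑ j : Fin p, (p : ℝ) ^
                (-GolfBound.rhoStar (GolfBound.strength σ r p) ϑ r a (X.transpose * X) j))
            ≤ GolfBound.minimaxHamming σ ϑ r a X := by
  classical
  open GolfBound in
  set C := ϑ + r / 4 with hC
  set q : ℝ := (1 - 2 ^ (-ϑ)) ^ ⌊2 * C / ϑ⌋₊ with hq
  have hqpos : 0 < q := pow_pos (sub_pos.2
    (Real.rpow_lt_one_of_one_lt_of_neg one_lt_two (neg_neg_of_pos hϑ₀))) _
  have hCpos : 0 < C := by positivity
  -- The constant `q` is the price of the zeros of `b` inside the unions, and `1 / 2` that of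
  -- averaging over coins.
  refine ⟨fun p => q / 2 * testingFactor C p,
    isMultiLog_const_mul_testingFactor (by positivity) hCpos.le, ?_⟩
  filter_upwards [eventually_ge_atTop 2] with p hp n X hX V hV
  have hp1 : (1 : ℝ) ≤ p := by exact_mod_cast (by omega : 1 ≤ p)
  set ρ := rhoStar (strength σ r p) ϑ r a (X.transpose * X) with hρ
  set η : Fin p → ℝ := fun j => eta (strength σ r p) ϑ r a (X.transpose * X) (V j).1 (V j).2 with hη
  obtain ⟨J, hJ, hsum⟩ := exists_independent_sum_le (golfAdj V) (d := golfDegree V)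
    (w := fun j => (p : ℝ) ^ (-ρ j))
    (fun j => ⟨j, Finset.mem_inter.2 ⟨(hV j).1, (hV j).1⟩⟩)
    (fun j k h => by rwa [golfAdj, Finset.inter_comm])
    (fun j => by
      rw [golfDegree]
      convert Finset.le_sup (f := fun j => (Finset.univ.filter fun k => golfAdj V j k).card)
        (Finset.mem_univ j)) (fun j => by positivity)
  have hdisj : (J : Set (Fin p)).PairwiseDisjoint fun j => (V j).1 ∪ (V j).2 := by
    intro j hj k hk hjk
    rw [Function.onFun, Finset.disjoint_iff_inter_eq_empty, ← Finset.not_nonempty_iff_eq_empty]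
    exact fun h => hjk (hJ j hj k hk h)
  have hmain := sum_le_two_mul_minimaxHamming hσ hϑ₀ hr ha hp X (fun j => (hV j).1)
    (eta_le_of_isLeastFavorable hσ hϑ₀ hr ha hp hX.2.1 hV) hdisj
  have ht : 0 < testingFactor C p := by unfold testingFactor; positivity
  have hfrac : (golfDegree V : ℝ)⁻¹ * ∑ j, (p : ℝ) ^ (-ρ j) ≤ ∑ j ∈ J, (p : ℝ) ^ (-ρ j) := by
    -- For degree `0` the inverse is `0` by convention and the left side vanishes.
    rcases Nat.eq_zero_or_pos (golfDegree V) with h0 | hpos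
    · rw [h0, Nat.cast_zero, inv_zero, zero_mul]
      positivity
    · rwa [inv_mul_le_iff₀ (by exact_mod_cast hpos)]
  rw [← ENNReal.ofReal_sum_of_nonneg fun j _ => by positivity] at hmain
  refine (ENNReal.mul_le_mul_iff_right two_ne_zero ENNReal.ofNat_ne_top).1 (le_trans ?_ hmain)
  rw [← ENNReal.ofReal_ofNat 2, ← ENNReal.ofReal_mul (by norm_num)]
  refine ENNReal.ofReal_le_ofReal ?_
  rw [← Finset.mul_sum, ← Finset.mul_sum]
  calc 2 * (q / 2 * testingFactor C p * (golfDegree V : ℝ)⁻¹ * ∑ j, (p : ℝ) ^ (-ρ j))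
      = q * (testingFactor C p * ((golfDegree V : ℝ)⁻¹ * ∑ j, (p : ℝ) ^ (-ρ j))) := by ring
    _ ≤ q * (testingFactor C p * ∑ j ∈ J, (p : ℝ) ^ (-ρ j)) := by gcongr
    _ ≤ q * (testingFactor C p * ∑ j ∈ J, (p : ℝ) ^ (-η j)) := by
        gcongr with j _
        exact eta_le_rhoStar hV j
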